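/- Let $G$ be an $n$-dimensional (real, smooth) Lie group with Lie algebra $\mathfrak g$ of left invariant vector fields, and let $g^1,g^2$ be two left invariant Riemannian metrics on $G$. For a vector field $X$ on $G$ let $X^v$ and $X^c$ denote its vertical and complete lifts to $TG$: $X^v(x,y)$ is the velocity at $t=0$ of $t\mapsto y+tX(x)\in T_xG$, and $X^c$ is the vector field whose flow is the tangent map of the flow of $X$, i.e. $X^c=\sum_i X^i\,\partial_{x^i}+\sum_{i,j}y^j\,(\partial_{x^j}X^i)\,\partial_{y^i}$ in the coordinates $(x,y)$ of $TG$ induced by a chart of $G$. Let $\varphi:\mathfrak g\to\mathfrak g$ be the linear map with $g^2(X,Y)=g^1(\varphi(X),Y)$ for all $X,Y\in\mathfrak g$, let $\{X_1,\dots,X_n\}$ be a $g^1$-orthonormal basis of $\mathfrak g$ consisting of eigenvectors of $\varphi$, $\varphi(X_i)=\lambda_iX_i$, and let $c_{ij}^k$ be the structure constants, $[X_i,X_j]=\sum_k c_{ij}^kX_k$. Then all $\lambda_i$ are positive, and there is exactly one smooth Riemannian metric $\tilde g$ on $TG$ such that, for all $X,Y\in\mathfrak g$ and at every point of $TG$,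 $$\tilde g(X^c,Y^c)=g^1(X,Y),\qquad \tilde g(X^v,Y^v)=g^2(X,Y),\qquad \tilde g(X^c,Y^v)=0.$$ The vector fields $\frac{X_1^v}{\sqrt{\lambda_1}},\dots,\frac{X_n^v}{\sqrt{\lambda_n}},X_1^c,\dots,X_n^c$ are $\tilde g$-orthonormal at every point of $TG$. The Levi-Civita connection $\tilde\nabla$ of $(TG,\tilde g)$ exists and satisfies, for all $1\le i,j\le n$, 1. $\displaystyle\tilde\nabla_{\frac{X_i^v}{\sqrt{\lambda_i}}}\frac{X_j^v}{\sqrt{\lambda_j}}=\frac12\sum_{l=1}^n\Big(\frac{\sqrt{\lambda_j}}{\sqrt{\lambda_i}}\,c_{li}^j-\frac{\sqrt{\lambda_i}}{\sqrt{\lambda_j}}\,c_{jl}^i\Big)X_l^c$, 2. $\displaystyle\tilde\nabla_{X_i^c}X_j^c=\frac12\sum_{l=1}^n\big(c_{ij}^l-c_{jl}^i+c_{li}^j\big)X_l^c$, 3. $\displaystyle\tilde\nabla_{X_i^c}\frac{X_j^v}{\sqrt{\lambda_j}}=\frac12\sum_{l=1}^n\Big(\frac{\sqrt{\lambda_l}}{\sqrt{\lambda_j}}\,c_{ij}^l+\frac{\sqrt{\lambda_j}}{\sqrt{\lambda_l}}\,c_{li}^j\Big)\frac{X_l^v}{\sqrt{\lambda_l}}$,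 4. $\displaystyle\tilde\nabla_{\frac{X_i^v}{\sqrt{\lambda_i}}}X_j^c=\frac12\sum_{l=1}^n\Big(\frac{\sqrt{\lambda_l}}{\sqrt{\lambda_i}}\,c_{ij}^l-\frac{\sqrt{\lambda_i}}{\sqrt{\lambda_l}}\,c_{jl}^i\Big)\frac{X_l^v}{\sqrt{\lambda_l}}$. -/

import Mathlib

open Bundle Manifold VectorField
open scoped ContDiff

noncomputable section

namespace LiftedMetric

section Manifold

variable {E : Type*} [NormedAddCommGroup E] [NormedSpace ℝ E]
  {H : Type*} [TopologicalSpace H] {I : ModelWithCorners ℝ E H}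
  {M : Type*} [TopologicalSpace M] [ChartedSpace H M]

/-- The vertical lift to `TM` of a vector field `X` on `M`: its value at `p = (x, y)` is the
velocity at `t = 0` of the curve `t ↦ y + t X(x)` in the fibre `T_x M ⊆ TM`. (This curve passes
through `p` at `t = 0`, so the velocity is a vector of `T_p(TM)`.) -/
def verticalLift [IsManifold I 1 M] (X : Π x : M, TangentSpace I x) (p : TangentBundle I M) :
    TangentSpace I.tangent p :=
  mfderiv 𝓘(ℝ, ℝ) I.tangent
    (fun t : ℝ ↦ (⟨p.1, p.2 + t • X p.1⟩ : TangentBundle I M)) 0 (1 : ℝ)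

/-- The complete lift to `TM` of a vector field `X` on `M`, i.e. the vector field on `TM` whose
flow is the tangent map of the flow of `X`, given by its usual expression
`X^c = ∑ X^i ∂/∂x^i + ∑ y^j (∂X^i/∂x^j) ∂/∂y^i` in the coordinates `(x, y)` of `TM` induced by a
chart of `M`. At `p = (x, y)` we use the preferred chart of `M` at `x`: the induced chart is the
preferred chart of `TM` at `p`, in which `T_p(TM)` is `E × E`, the horizontal component of `X^c` is
`X x`, and the vertical component is the derivative in the direction `y` of the coordinate
expression of `X` (the pullback of `X` under the inverse of the chart). -/
def completeLift [IsManifold I 1 M] (X : Π x : M, TangentSpace I x) (p : TangentBundle I M) :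
    TangentSpace I.tangent p :=
  (X p.1, fderivWithin ℝ (mpullbackWithin 𝓘(ℝ, E) I (extChartAt I p.1).symm X (Set.range I))
    (Set.range I) (extChartAt I p.1 p.1) p.2)

variable (I M) in
/-- Smooth Riemannian metrics on `M`. -/
abbrev Metric [IsManifold I 1 M] :=
  ContMDiffRiemannianMetric I ∞ E (fun x : M ↦ TangentSpace I x)

/-- `cov` is the Levi-Civita connection of the Riemannian metric `g`: it is torsion-free and
compatible with `g`, i.e. `X(g(Y, Z)) = g(∇_X Y, Z) + g(Y, ∇_X Z)` (at each point `x`, for all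
vector fields `Y`, `Z` differentiable at `x` and all tangent vectors `v = X(x)`).
Here `cov Y x v` is `∇_v Y`. -/
def IsLeviCivita [FiniteDimensional ℝ E] [IsManifold I 2 M] (g : Metric I M)
    (cov : CovariantDerivative I E (TangentSpace I : M → Type _)) : Prop :=
  haveI : CompleteSpace E := FiniteDimensional.complete ℝ E
  cov.torsion = 0 ∧
    ∀ (x : M) (Y Z : Π y : M, TangentSpace I y), MDiffAt (T% Y) x → MDiffAt (T% Z) x →
      ∀ v : TangentSpace I x,
        mvfderiv I (fun y : M ↦ g.inner y (Y y) (Z y)) x v =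
          g.inner x (cov Y x v) (Z x) + g.inner x (Y x) (cov Z x v)

end Manifold

section LieGroup

variable {E : Type*} [NormedAddCommGroup E] [NormedSpace ℝ E]
  {H : Type*} [TopologicalSpace H] {I : ModelWithCorners ℝ E H}
  {G : Type*} [TopologicalSpace G] [ChartedSpace H G] [Group G] [LieGroup I ∞ G]

/-- The Riemannian metric `g` on the Lie group `G` is left invariant: all left translations are
isometries. -/
def IsLeftInvariant (g : Metric I G) : Prop :=
  ∀ (a x : G) (u v : TangentSpace I x),
    g.inner (a * x) (mfderiv I I (fun y : G ↦ a * y) x u) (mfderiv I I (fun y : G ↦ a * y) x v) =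
      g.inner x u v

/-- The Riemannian metric `g` on `TG` is the lift of the left invariant metrics `g₁`, `g₂` on `G`:
`g(X^c, Y^c) = g₁(X, Y)`, `g(X^v, Y^v) = g₂(X, Y)` and `g(X^c, Y^v) = 0` at every point of `TG`,
for all left invariant vector fields `X`, `Y` on `G` (the invariant fields of `u`, `v`). -/
def IsLiftedMetric (g₁ g₂ : Metric I G) (g : Metric I.tangent (TangentBundle I G)) : Prop :=
  ∀ (u v : GroupLieAlgebra I G) (p : TangentBundle I G),
    g.inner p (completeLift (mulInvariantVectorField u) p)
        (completeLift (mulInvariantVectorField v) p) =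
      g₁.inner p.1 (mulInvariantVectorField u p.1) (mulInvariantVectorField v p.1) ∧
    g.inner p (verticalLift (mulInvariantVectorField u) p)
        (verticalLift (mulInvariantVectorField v) p) =
      g₂.inner p.1 (mulInvariantVectorField u p.1) (mulInvariantVectorField v p.1) ∧
    g.inner p (completeLift (mulInvariantVectorField u) p)
        (verticalLift (mulInvariantVectorField v) p) = 0

/-- The inner product `⟨ , ⟩` on the Lie algebra given by the metric `g` at the identity. -/
def innerAtOne (g : Metric I G) : LinearMap.BilinForm ℝ (GroupLieAlgebra I G) :=
  LinearMap.mk₂ ℝ (fun u v ↦ g.inner 1 u v) (by simp) (by simp) (by simp) (by simp)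

theorem innerAtOne_nondegenerate (g : Metric I G) : (innerAtOne g).Nondegenerate := by
  constructor
  · intro u hu
    by_contra h
    exact (g.pos 1 u h).ne' (hu u)
  · intro u hu
    by_contra h
    exact (g.pos 1 u h).ne' (hu u)

instance [FiniteDimensional ℝ E] : FiniteDimensional ℝ (GroupLieAlgebra I G) :=
  inferInstanceAs (FiniteDimensional ℝ E)

/-- The linear map `φ` of the Lie algebra with `⟨X, Y⟩₂ = ⟨φ X, Y⟩₁` for all `X`, `Y`. -/
def comparison [FiniteDimensional ℝ E] (g₁ g₂ : Metric I G) :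
    Module.End ℝ (GroupLieAlgebra I G) :=
  LinearMap.BilinForm.symmCompOfNondegenerate (innerAtOne g₂) (innerAtOne g₁)
    (innerAtOne_nondegenerate g₁)

theorem innerAtOne_comparison [FiniteDimensional ℝ E] (g₁ g₂ : Metric I G)
    (u v : GroupLieAlgebra I G) :
    g₂.inner 1 u v = g₁.inner 1 (comparison g₁ g₂ u) v :=
  (LinearMap.BilinForm.symmCompOfNondegenerate_left_apply (innerAtOne g₂)
    (innerAtOne_nondegenerate g₁) v u).symm

/-- The structure constants `c_{ij}^k` of the Lie algebra in the basis `X`: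
`[X_i, X_j] = ∑ k, c_{ij}^k X_k`. -/
def structureConst {ι : Type*} (X : Module.Basis ι ℝ (GroupLieAlgebra I G)) (i j k : ι) : ℝ :=
  X.repr ⁅X i, X j⁆ k

/-- The vector field `X_i^c` on `TG`, where `X_i` is regarded as a left invariant field. -/
def frameC {ι : Type*} (X : Module.Basis ι ℝ (GroupLieAlgebra I G)) (i : ι)
    (p : TangentBundle I G) : TangentSpace I.tangent p :=
  completeLift (mulInvariantVectorField (X i)) p

/-- The vector field `X_i^v / √λ_i` on `TG`, where `X_i` is regarded as a left invariant field. -/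
def frameV {ι : Type*} (X : Module.Basis ι ℝ (GroupLieAlgebra I G)) (lam : ι → ℝ) (i : ι)
    (p : TangentBundle I G) : TangentSpace I.tangent p :=
  (1 / √(lam i)) • verticalLift (mulInvariantVectorField (X i)) p

end LieGroup

end LiftedMetric

end

noncomputable section

namespace LiftedMetric

/-! ### Derivative of a finite sum -/

section Derivative

variable {E : Type*} [NormedAddCommGroup E] [NormedSpace ℝ E]
  {H : Type*} [TopologicalSpace H] {I : ModelWithCorners ℝ E H}
  {M : Type*} [TopologicalSpace M] [ChartedSpace H M]

/-! Everything is controlled by the global frame of `TG` formed by the fields `X_i^v / √λ_i` and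
`X_i^c`. Since `g₂(X_i, X_j) = λ_i δ_ij` at the identity, and left invariance makes the products of
invariant fields constant, bilinearity shows that a metric is the lifted metric exactly when this
frame is orthonormal (`isLiftedMetric_iff_isOrthonormalFrame`). A global smooth frame is orthonormal
for exactly one metric (`frameMetric`, `IsOrthonormalFrame.metric_ext`), which gives existence and
uniqueness.

In an orthonormal frame the products `g(F_b, F_c)` are constant, so Koszul's formula leaves only
brackets: with `[F_a, F_b] = ∑ B_ab^c F_c`, the Levi-Civita connection satisfies `g(∇_{F_a} F_b,
F_c) = (B_ab^c - B_bc^a + B_ca^b) / 2` (`IsLeviCivita.apply_frame`). Conversely, the connection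
making the frame parallel, corrected by these symbols, is Levi-Civita (`exists_isLeviCivita`).

It remains to know the brackets of lifts: `[X^c, Y^c] = [X, Y]^c`, `[X^c, Y^v] = [X, Y]^v`, `[X^v,
Y^v] = 0`. They are computed on `E × E`, where they follow from the symmetry of second derivatives,
and transported through charts of `TG`. The transport needs the coordinate formulas of the lifts to
be compatible with changes of chart, because the complete lift is defined at each point by that
point's own preferred chart. Normalizing the vertical fields turns structure constants into the
ratios `√λ_k / √λ_j`. -/

theorem mvfderiv_finset_sum {ι : Type*} {s : Finset ι} {f : ι → M → ℝ} {x : M}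
    (hf : ∀ i, MDiffAt (f i) x) :
    mvfderiv I (fun y ↦ ∑ i ∈ s, f i y) x = ∑ i ∈ s, mvfderiv I (f i) x := by
  classical
  -- Differentiability of the partial sums is carried through the induction because the sum rule
  -- requires it.
  have : MDiffAt (fun y ↦ ∑ i ∈ s, f i y) x ∧
      mvfderiv I (fun y ↦ ∑ i ∈ s, f i y) x = ∑ i ∈ s, mvfderiv I (f i) x := by
    induction s using Finset.induction_on with
    | empty => exact ⟨by simpa using mdifferentiableAt_const, by simp [mvfderiv_const]⟩
    | insert i s hi ih =>
      simp only [Finset.sum_insert hi]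
      exact ⟨(hf i).add ih.1, by rw [← ih.2]; exact mvfderiv_add (hf i) ih.1⟩
  exact this.2

end Derivative

/-! ### Levi-Civita connection of a metric with a global orthonormal frame -/

section OrthonormalFrame

variable {E : Type*} [NormedAddCommGroup E] [NormedSpace ℝ E]
  {H : Type*} [TopologicalSpace H] {I : ModelWithCorners ℝ E H}
  {M : Type*} [TopologicalSpace M] [ChartedSpace H M]
  {ι : Type*} {F : ι → Π x : M, TangentSpace I x}

theorem coeff_frame [DecidableEq ι] [IsManifold I 1 M] (hF : IsLocalFrameOn I E ∞ F Set.univ)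
    (x : M) (i j : ι) : hF.coeff i x (F j x) = if j = i then 1 else 0 := by
  rw [hF.coeff_apply_of_mem (Set.mem_univ x), ← hF.toBasisAt_coe (Set.mem_univ x),
    Module.Basis.repr_self, Finsupp.single_apply]

theorem sum_coeff_smul [Fintype ι] [IsManifold I 1 M] (hF : IsLocalFrameOn I E ∞ F Set.univ)
    (x : M) (u : TangentSpace I x) : ∑ i, hF.coeff i x u • F i x = u := by
  have h := (hF.toBasisAt (Set.mem_univ x)).sum_repr u
  simpa [IsLocalFrameOn.coeff] using h

/-- The frame `F` is orthonormal for the metric `g`. -/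
def IsOrthonormalFrame [DecidableEq ι] [IsManifold I 1 M] (g : Metric I M)
    (F : ι → Π x : M, TangentSpace I x) : Prop :=
  ∀ (x : M) (i j : ι), g.inner x (F i x) (F j x) = if i = j then 1 else 0

variable [Fintype ι] [DecidableEq ι]

section

variable [IsManifold I 1 M] {g : Metric I M}

theorem inner_eq_sum_coeff (hF : IsLocalFrameOn I E ∞ F Set.univ) (hg : IsOrthonormalFrame g F)
    (x : M) (u v : TangentSpace I x) :
    g.inner x u v = ∑ i, hF.coeff i x u * hF.coeff i x v := by
  conv_lhs => rw [← sum_coeff_smul hF x u, ← sum_coeff_smul hF x v]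
  simp only [map_sum, map_smul, _root_.sum_apply, _root_.smul_apply,
    hg x, smul_eq_mul]
  simp [mul_comm]

theorem inner_frame (hF : IsLocalFrameOn I E ∞ F Set.univ) (hg : IsOrthonormalFrame g F)
    (x : M) (i : ι) (u : TangentSpace I x) :
    g.inner x u (F i x) = hF.coeff i x u := by
  simp only [inner_eq_sum_coeff hF hg, coeff_frame]
  simp

/-- By orthonormality a coefficient is the inner product with a smooth frame field, and inner
products of differentiable fields are differentiable. -/
theorem mdifferentiableAt_coeff (hF : IsLocalFrameOn I E ∞ F Set.univ)
    (hg : IsOrthonormalFrame g F) {x : M} {Y : Π x : M, TangentSpace I x}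
    (hY : MDiffAt (T% Y) x) (i : ι) : MDiffAt (fun y ↦ hF.coeff i y (Y y)) x := by
  let : RiemannianBundle (fun x : M ↦ TangentSpace I x) := ⟨g.toRiemannianMetric⟩
  have : IsContMDiffRiemannianBundle I 1 E (fun x : M ↦ TangentSpace I x) :=
    IsContMDiffRiemannianBundle.of_le (n := ∞) (by simp)
  have := MDifferentiableAt.inner_bundle (F := E) (IB := I) (E := fun x : M ↦ TangentSpace I x)
    (b := id) hY (((hF.contMDiffOn i).contMDiffAt Filter.univ_mem).mdifferentiableAt (by simp))
  simp only [← inner_frame hF hg]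
  exact this

/-- The connection for which the frame `F` is parallel. -/
def flatConnection (hF : IsLocalFrameOn I E ∞ F Set.univ) (hg : IsOrthonormalFrame g F) :
    CovariantDerivative I E (TangentSpace I : M → Type _) where
  toFun Y x := ∑ i, (mvfderiv I (fun y ↦ hF.coeff i y (Y y)) x).smulRight (F i x)
  isCovariantDerivativeOnUniv :=
    { add := by
        intro Y Z x hY hZ _
        have h i : mvfderiv I (fun y ↦ hF.coeff i y ((Y + Z) y)) x =
            mvfderiv I (fun y ↦ hF.coeff i y (Y y)) x +
              mvfderiv I (fun y ↦ hF.coeff i y (Z y)) x := by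
          rw [← mvfderiv_add (mdifferentiableAt_coeff hF hg hY i)
            (mdifferentiableAt_coeff hF hg hZ i)]
          congr 1
          ext y
          simp
        simp_rw [h]
        ext v
        simp [add_smul, Finset.sum_add_distrib]
      leibniz := by
        intro Y f x hY hf _
        have h i : mvfderiv I (fun y ↦ hF.coeff i y ((f • Y) y)) x =
            f x • mvfderiv I (fun y ↦ hF.coeff i y (Y y)) x +
              hF.coeff i x (Y x) • mvfderiv I f x := by
          rw [← mvfderiv_mul hf (mdifferentiableAt_coeff hF hg hY i)]
          congr 1
          ext y
          simp
        simp_rw [h]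
        ext v
        conv_rhs => rw [← sum_coeff_smul hF x (Y x)]
        simp [add_smul, Finset.sum_add_distrib, Finset.smul_sum, smul_smul, mul_comm] }

end

theorem flatConnection_apply [IsManifold I 1 M] {g : Metric I M}
    (hF : IsLocalFrameOn I E ∞ F Set.univ) (hg : IsOrthonormalFrame g F)
    (Y : Π x : M, TangentSpace I x) (x : M) (v : TangentSpace I x) :
    flatConnection hF hg Y x v = ∑ i, mvfderiv I (fun y ↦ hF.coeff i y (Y y)) x v • F i x := by
  simp [flatConnection]

variable [FiniteDimensional ℝ E] [IsManifold I 2 M] {g : Metric I M}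

instance (x : M) : FiniteDimensional ℝ (TangentSpace I x) :=
  inferInstanceAs (FiniteDimensional ℝ E)

instance (x : M) : T2Space (TangentSpace I x) :=
  inferInstanceAs (T2Space E)

/-- The coefficients of the Lie brackets of the vector fields of a frame. -/
def bracketCoeff (hF : IsLocalFrameOn I E ∞ F Set.univ) (x : M) (a b c : ι) : ℝ :=
  hF.coeff c x (mlieBracket I (F a) (F b) x)

omit [Fintype ι] [DecidableEq ι] [FiniteDimensional ℝ E] in
theorem bracketCoeff_swap (hF : IsLocalFrameOn I E ∞ F Set.univ) (x : M) (a b c : ι) :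
    bracketCoeff hF x a b c = -bracketCoeff hF x b a c := by
  rw [bracketCoeff, mlieBracket_swap_apply, map_neg, bracketCoeff]

/-- The Christoffel symbols `g(∇_{F_a} F_b, F_c)` of the Levi-Civita connection of a metric for which
the frame `F` is orthonormal. -/
def christoffel (hF : IsLocalFrameOn I E ∞ F Set.univ) (x : M) (a b c : ι) : ℝ :=
  (1 / 2) * (bracketCoeff hF x a b c - bracketCoeff hF x b c a + bracketCoeff hF x c a b)

/-- The one-form with values in endomorphisms given by the Christoffel symbols. -/
def christoffelForm (hF : IsLocalFrameOn I E ∞ F Set.univ) (x : M) :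
    TangentSpace I x →L[ℝ] TangentSpace I x →L[ℝ] TangentSpace I x :=
  ∑ a, ∑ b, ∑ c, christoffel hF x a b c •
    (LinearMap.toContinuousLinearMap (hF.coeff b x)).smulRight
      ((LinearMap.toContinuousLinearMap (hF.coeff a x)).smulRight (F c x))

omit [DecidableEq ι] in
theorem christoffelForm_apply (hF : IsLocalFrameOn I E ∞ F Set.univ) (x : M)
    (y v : TangentSpace I x) :
    christoffelForm hF x y v =
      ∑ a, ∑ b, ∑ c, (christoffel hF x a b c * hF.coeff b x y * hF.coeff a x v) • F c x := by
  simp [christoffelForm, _root_.sum_apply, smul_smul, mul_assoc]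

theorem christoffelForm_frame (hF : IsLocalFrameOn I E ∞ F Set.univ) (x : M) (a b : ι) :
    christoffelForm hF x (F b x) (F a x) = ∑ c, christoffel hF x a b c • F c x := by
  simp only [christoffelForm_apply, coeff_frame]
  simp [Finset.sum_ite_eq, ite_smul]

omit [Fintype ι] [DecidableEq ι] [FiniteDimensional ℝ E] in
-- Skewness in the last two indices is metric compatibility at the level of symbols.
theorem christoffel_swap (hF : IsLocalFrameOn I E ∞ F Set.univ) (x : M) (a b c : ι) :
    christoffel hF x a b c = -christoffel hF x a c b := by
  rw [christoffel, christoffel, bracketCoeff_swap hF x b c a, bracketCoeff_swap hF x c a b,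
    bracketCoeff_swap hF x b a c]
  ring

theorem inner_christoffelForm (hF : IsLocalFrameOn I E ∞ F Set.univ)
    (hg : IsOrthonormalFrame g F) (x : M) (y z v : TangentSpace I x) :
    g.inner x (christoffelForm hF x y v) z =
      ∑ a, ∑ b, ∑ c, christoffel hF x a b c * hF.coeff b x y * hF.coeff a x v * hF.coeff c x z := by
  rw [g.symm]
  simp only [christoffelForm_apply, map_sum, map_smul, inner_frame hF hg, smul_eq_mul]

/-- The correction term takes values in skew-adjoint endomorphisms, so adding it to a metric
connection preserves compatibility. -/
theorem inner_christoffelForm_add (hF : IsLocalFrameOn I E ∞ F Set.univ)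
    (hg : IsOrthonormalFrame g F) (x : M) (y z v : TangentSpace I x) :
    g.inner x (christoffelForm hF x y v) z + g.inner x y (christoffelForm hF x z v) = 0 := by
  rw [g.symm x y, inner_christoffelForm hF hg, inner_christoffelForm hF hg,
    ← Finset.sum_add_distrib]
  refine Finset.sum_eq_zero fun a _ ↦ ?_
  -- Exchanging the two inner sums of the second term pairs the symbol `a b c` with `a c b`, and the
  -- pair cancels.
  conv_lhs => enter [2]; rw [Finset.sum_comm]
  simp_rw [← Finset.sum_add_distrib]
  refine Finset.sum_eq_zero fun b _ ↦ Finset.sum_eq_zero fun c _ ↦ ?_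
  rw [christoffel_swap hF x a c b]
  ring

theorem flatConnection_frame (hF : IsLocalFrameOn I E ∞ F Set.univ)
    (hg : IsOrthonormalFrame g F) (x : M) (a : ι) : flatConnection hF hg (F a) x = 0 := by
  ext1 v
  rw [flatConnection_apply]
  refine Finset.sum_eq_zero fun i _ ↦ ?_
  have : (fun y ↦ hF.coeff i y (F a y)) = fun _ ↦ if a = i then 1 else 0 := by
    ext y
    exact coeff_frame hF y i a
  rw [this, mvfderiv_const]
  simp

/-- In frame coefficients the metric is the constant Euclidean product and the flat connection
differentiates coefficients, so compatibility is the product rule. -/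
theorem mvfderiv_inner (hF : IsLocalFrameOn I E ∞ F Set.univ)
    (hg : IsOrthonormalFrame g F) (x : M) {Y Z : Π y : M, TangentSpace I y}
    (hY : MDiffAt (T% Y) x) (hZ : MDiffAt (T% Z) x) (v : TangentSpace I x) :
    mvfderiv I (fun y : M ↦ g.inner y (Y y) (Z y)) x v =
      g.inner x (flatConnection hF hg Y x v) (Z x) +
        g.inner x (Y x) (flatConnection hF hg Z x v) := by
  have h : mvfderiv I (fun y : M ↦ g.inner y (Y y) (Z y)) x =
      ∑ i, mvfderiv I (fun y : M ↦ hF.coeff i y (Y y) * hF.coeff i y (Z y)) x := by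
    rw [show (fun y : M ↦ g.inner y (Y y) (Z y)) =
      fun y : M ↦ ∑ i, hF.coeff i y (Y y) * hF.coeff i y (Z y) from
      funext fun y ↦ inner_eq_sum_coeff hF hg y _ _]
    exact mvfderiv_finset_sum fun i ↦
      (mdifferentiableAt_coeff hF hg hY i).mul (mdifferentiableAt_coeff hF hg hZ i)
  rw [h, g.symm x _ (Z x)]
  simp only [_root_.sum_apply, flatConnection_apply, map_sum, map_smul, inner_frame hF hg,
    smul_eq_mul]
  rw [← Finset.sum_add_distrib]
  refine Finset.sum_congr rfl fun i _ ↦ ?_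
  have := mvfderiv_mul (mdifferentiableAt_coeff hF hg hY i) (mdifferentiableAt_coeff hF hg hZ i)
  rw [show (fun y : M ↦ hF.coeff i y (Y y) * hF.coeff i y (Z y)) =
    (fun y : M ↦ hF.coeff i y (Y y)) * (fun y : M ↦ hF.coeff i y (Z y)) from rfl, this]
  simp
  ring

theorem exists_isLeviCivita (hF : IsLocalFrameOn I E ∞ F Set.univ)
    (hg : IsOrthonormalFrame g F) : ∃ cov, IsLeviCivita g cov := by
  have : CompleteSpace E := FiniteDimensional.complete ℝ E
  refine ⟨(flatConnection hF hg).addOneForm (christoffelForm hF), ?_, ?_⟩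
  · ext1 x
    have hmd (a : ι) : MDiffAt (T% (F a)) x :=
      ((hF.contMDiffOn a).contMDiffAt Filter.univ_mem).mdifferentiableAt (by simp)
    set T := ((flatConnection hF hg).addOneForm (christoffelForm hF)).torsion x with hT
    -- Torsion is a tensor, so it suffices to test it on the frame. There the flat part contributes
    -- nothing, and the difference of two symbols is the bracket coefficient.
    have key (a b : ι) : T (F a x) (F b x) = 0 := by
      rw [hT, CovariantDerivative.torsion_apply _ (hmd a) (hmd b)]
      have h (a b : ι) : (flatConnection hF hg).addOneForm (christoffelForm hF) (F b) x (F a x) =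
          ∑ c, christoffel hF x a b c • F c x := by
        rw [← christoffelForm_frame]
        change (flatConnection hF hg (F b) x + _) _ = _
        rw [flatConnection_frame, zero_add]
      rw [h, h, ← sum_coeff_smul hF x (mlieBracket I (F a) (F b) x), ← Finset.sum_sub_distrib,
        ← Finset.sum_sub_distrib]
      refine Finset.sum_eq_zero fun c _ ↦ ?_
      rw [← sub_smul, ← sub_smul]
      change (_ - _ - bracketCoeff hF x a b c) • _ = _
      rw [christoffel, christoffel, bracketCoeff_swap hF x b a c, bracketCoeff_swap hF x c b a,
        bracketCoeff_swap hF x a c b]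
      ring_nf
      exact zero_smul _ _
    ext1 u
    ext1 v
    rw [← sum_coeff_smul hF x u, ← sum_coeff_smul hF x v]
    simp [key]
  · intro x Y Z hY hZ v
    rw [mvfderiv_inner hF hg x hY hZ]
    change _ = g.inner x (flatConnection hF hg Y x v + christoffelForm hF x (Y x) v) (Z x) +
      g.inner x (Y x) (flatConnection hF hg Z x v + christoffelForm hF x (Z x) v)
    have := inner_christoffelForm_add hF hg x (Y x) (Z x) v
    simp only [map_add, _root_.add_apply]
    linarith

/-- Koszul's argument: three instances of vanishing torsion and three of compatibility with constant
inner products form a linear system that determines the coefficients of `∇_{F_a} F_b`. -/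
theorem IsLeviCivita.apply_frame {cov : CovariantDerivative I E (TangentSpace I : M → Type _)}
    (hcov : IsLeviCivita g cov) (hF : IsLocalFrameOn I E ∞ F Set.univ)
    (hg : IsOrthonormalFrame g F) (x : M) (a b : ι) :
    cov (F b) x (F a x) = ∑ c, christoffel hF x a b c • F c x := by
  have : CompleteSpace E := FiniteDimensional.complete ℝ E
  have hmd (a : ι) : MDiffAt (T% (F a)) x :=
    ((hF.contMDiffOn a).contMDiffAt Filter.univ_mem).mdifferentiableAt (by simp)
  have compat (a b c : ι) : hF.coeff c x (cov (F b) x (F a x)) +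
      hF.coeff b x (cov (F c) x (F a x)) = 0 := by
    have h := hcov.2 x (F b) (F c) (hmd b) (hmd c) (F a x)
    rw [g.symm x (F b x), inner_frame hF hg, inner_frame hF hg] at h
    rw [← h, show (fun y : M ↦ g.inner y (F b y) (F c y)) = fun _ ↦ if b = c then 1 else 0 from
      funext fun y ↦ hg y b c, mvfderiv_const]
    rfl
  have tors (a b c : ι) : hF.coeff c x (cov (F b) x (F a x)) -
      hF.coeff c x (cov (F a) x (F b x)) = bracketCoeff hF x a b c := by
    rw [bracketCoeff, ← (cov.torsion_eq_zero_iff.1 hcov.1) (hmd a) (hmd b), map_sub]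
  conv_lhs => rw [← sum_coeff_smul hF x (cov (F b) x (F a x))]
  refine Finset.sum_congr rfl fun c _ ↦ ?_
  congr 1
  rw [christoffel, ← tors, ← tors, ← tors]
  linarith [compat a b c, compat b a c, compat c a b]

end OrthonormalFrame

/-! ### The unique metric making a global frame orthonormal -/

section FrameMetric

variable {E : Type*} [NormedAddCommGroup E] [NormedSpace ℝ E] [FiniteDimensional ℝ E]
  {H : Type*} [TopologicalSpace H] {I : ModelWithCorners ℝ E H}
  {M : Type*} [TopologicalSpace M] [ChartedSpace H M] [IsManifold I ∞ M]
  {ι : Type*} [Fintype ι] [DecidableEq ι] {F : ι → Π x : M, TangentSpace I x}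

/-- The bilinear form on a tangent space for which the frame `F` is orthonormal. -/
def frameInner (hF : IsLocalFrameOn I E ∞ F Set.univ) (x : M) :
    TangentSpace I x →L[ℝ] TangentSpace I x →L[ℝ] ℝ :=
  ∑ i, (LinearMap.toContinuousLinearMap (hF.coeff i x)).smulRight
    (LinearMap.toContinuousLinearMap (hF.coeff i x))

theorem frameInner_apply (hF : IsLocalFrameOn I E ∞ F Set.univ) (x : M) (u v : TangentSpace I x) :
    frameInner hF x u v = ∑ i, hF.coeff i x u * hF.coeff i x v := by
  simp [frameInner, _root_.sum_apply]

theorem eq_zero_of_coeff_eq_zero (hF : IsLocalFrameOn I E ∞ F Set.univ) {x : M}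
    {u : TangentSpace I x} (h : ∀ i, hF.coeff i x u = 0) : u = 0 := by
  rw [← sum_coeff_smul hF x u]
  simp [h]

/-- In a local trivialization the frame is a smooth family `A x` of invertible maps from `ι → ℝ` to
`E`. Inversion is smooth at invertible maps, and the form is the pullback of the Euclidean one by
`(A x)⁻¹`. -/
theorem frameInner_contMDiff (hF : IsLocalFrameOn I E ∞ F Set.univ) :
    ContMDiff I (I.prod 𝓘(ℝ, E →L[ℝ] E →L[ℝ] ℝ)) ∞
      (fun x ↦ TotalSpace.mk' (E →L[ℝ] E →L[ℝ] ℝ)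
        (E := fun x : M ↦ TangentSpace I x →L[ℝ] TangentSpace I x →L[ℝ] ℝ) x
        (frameInner hF x)) := by
  intro x₀
  rw [contMDiffAt_section]
  set e := trivializationAt E (TangentSpace I : M → Type _) x₀ with he
  have hx₀ : x₀ ∈ e.baseSet := FiberBundle.mem_baseSet_trivializationAt' x₀
  let A : M → (ι → ℝ) →L[ℝ] E := fun x ↦
    ∑ i, (ContinuousLinearMap.proj (R := ℝ) (φ := fun _ : ι ↦ ℝ) i).smulRight (e ⟨x, F i x⟩).2
  have hA : ContMDiffAt I 𝓘(ℝ, (ι → ℝ) →L[ℝ] E) ∞ A x₀ := by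
    refine contMDiffAt_finsetSum fun i _ ↦ ?_
    have hi : ContMDiffAt I 𝓘(ℝ, E) ∞ (fun x ↦ (e ⟨x, F i x⟩).2) x₀ :=
      (contMDiffAt_section x₀).1 ((hF.contMDiffOn i).contMDiffAt Filter.univ_mem)
    exact (ContinuousLinearMap.contDiff (ContinuousLinearMap.smulRightL ℝ (ι → ℝ) E
      (ContinuousLinearMap.proj (R := ℝ) (φ := fun _ : ι ↦ ℝ) i))).contMDiff.contMDiffAt.comp x₀ hi
  -- The inverse of `A x` reads off the frame coefficients; this identifies the smooth expression
  -- `hC` with the form in coordinates.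
  have hAinv (x : M) (hx : x ∈ e.baseSet) : ∃ Φ : (ι → ℝ) ≃L[ℝ] E, A x = Φ ∧
      ∀ u i, Φ.symm u i = hF.coeff i x (e.symm x u) := by
    refine ⟨(hF.toBasisAt (Set.mem_univ x)).equivFun.symm.toContinuousLinearEquiv.trans
      (e.continuousLinearEquivAt ℝ x hx), ?_, ?_⟩
    · ext1 w
      simp only [A, _root_.sum_apply, ContinuousLinearMap.smulRight_apply,
        ContinuousLinearMap.proj_apply, ContinuousLinearEquiv.coe_coe,
        ContinuousLinearEquiv.trans_apply, LinearEquiv.coe_toContinuousLinearEquiv',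
        Module.Basis.equivFun_symm_apply, map_sum, map_smul, IsLocalFrameOn.toBasisAt_coe]
      rfl
    · intro u i
      rw [IsLocalFrameOn.coeff, dif_pos (Set.mem_univ x)]
      rfl
  have hB : ContMDiffAt I 𝓘(ℝ, E →L[ℝ] (ι → ℝ)) ∞ (fun x ↦ (A x).inverse) x₀ := by
    obtain ⟨Φ, hΦ, -⟩ := hAinv x₀ hx₀
    have h : ContDiffAt ℝ ∞ ContinuousLinearMap.inverse (A x₀) := hΦ ▸ contDiffAt_map_inverse Φ
    exact h.contMDiffAt.comp x₀ hA
  have hC : ContMDiffAt I 𝓘(ℝ, E →L[ℝ] E →L[ℝ] ℝ) ∞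
      (fun x ↦ ∑ i, ((ContinuousLinearMap.proj i).comp (A x).inverse : E →L[ℝ] ℝ).smulRight
        ((ContinuousLinearMap.proj i).comp (A x).inverse : E →L[ℝ] ℝ)) x₀ := by
    refine ContMDiffAt.comp (I' := 𝓘(ℝ, E →L[ℝ] (ι → ℝ))) x₀
      (g := fun L : E →L[ℝ] (ι → ℝ) ↦ ∑ i, ((ContinuousLinearMap.proj (R := ℝ) i).comp L).smulRight
        ((ContinuousLinearMap.proj (R := ℝ) i).comp L)) (ContDiff.contMDiff ?_).contMDiffAt hB
    refine ContDiff.sum fun i _ ↦ ?_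
    have hp : ContDiff ℝ ∞ (fun L : E →L[ℝ] (ι → ℝ) ↦
        (ContinuousLinearMap.proj (R := ℝ) (φ := fun _ : ι ↦ ℝ) i).comp L) :=
      contDiff_const.clm_comp contDiff_id
    exact hp.smulRight hp
  refine hC.congr_of_eventuallyEq ?_
  filter_upwards [e.open_baseSet.mem_nhds hx₀] with x hx
  ext u v
  obtain ⟨Φ, hΦ, h⟩ := hAinv x hx
  rw [hom_trivializationAt_apply]
  simp only []
  rw [inCoordinates_apply_eq₂ hx hx (Set.mem_univ _), frameInner_apply]
  simp [hΦ, h, _root_.sum_apply, he]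

/-- The Riemannian metric for which the frame `F` is orthonormal. -/
def frameMetric (hF : IsLocalFrameOn I E ∞ F Set.univ) : Metric I M where
  inner := frameInner hF
  symm x u v := by simp [frameInner_apply, mul_comm]
  pos x u hu := by
    rw [frameInner_apply]
    by_contra! h
    refine hu (eq_zero_of_coeff_eq_zero hF fun i ↦ ?_)
    have := (Finset.sum_eq_zero_iff_of_nonneg fun i _ ↦ mul_self_nonneg (hF.coeff i x u)).1
      (le_antisymm h (Finset.sum_nonneg fun i _ ↦ mul_self_nonneg _)) i (Finset.mem_univ i)
    exact mul_self_eq_zero.1 this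
  isVonNBounded x := by
    -- The unit ball of the form lies in the linear image of the sup-norm unit ball, since each
    -- squared coefficient is at most their sum.
    let f : (ι → ℝ) →L[ℝ] TangentSpace I x :=
      LinearMap.toContinuousLinearMap (hF.toBasisAt (Set.mem_univ x)).equivFun.symm.toLinearMap
    refine ((NormedSpace.isVonNBounded_closedBall ℝ (ι → ℝ) 1).image f).subset fun u hu ↦ ?_
    refine ⟨fun i ↦ hF.coeff i x u, ?_, ?_⟩
    · rw [mem_closedBall_zero_iff, pi_norm_le_iff_of_nonneg zero_le_one]
      intro i
      rw [Set.mem_ofPred_eq, frameInner_apply] at hu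
      have := Finset.single_le_sum (f := fun i ↦ hF.coeff i x u * hF.coeff i x u)
        (fun i _ ↦ mul_self_nonneg _) (Finset.mem_univ i)
      rw [Real.norm_eq_abs, abs_le_one_iff_mul_self_le_one]
      exact this.trans hu.le
    · change (hF.toBasisAt (Set.mem_univ x)).equivFun.symm _ = u
      rw [Module.Basis.equivFun_symm_apply]
      simpa using sum_coeff_smul hF x u
  contMDiff := frameInner_contMDiff hF

theorem isOrthonormalFrame_frameMetric (hF : IsLocalFrameOn I E ∞ F Set.univ) :
    IsOrthonormalFrame (frameMetric hF) F := by
  intro x i j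
  change frameInner hF x _ _ = _
  rw [frameInner_apply]
  simp only [coeff_frame]
  simp

theorem IsOrthonormalFrame.metric_ext (hF : IsLocalFrameOn I E ∞ F Set.univ) {g g' : Metric I M}
    (hg : IsOrthonormalFrame g F) (hg' : IsOrthonormalFrame g' F) : g = g' := by
  have : g.inner = g'.inner := by
    ext x u v
    rw [inner_eq_sum_coeff hF hg, inner_eq_sum_coeff hF hg']
  cases g
  cases g'
  congr

end FrameMetric

/-! ### Lifts of vector fields on a vector space: brackets and coordinate changes -/

section Calculus

variable {E : Type*} [NormedAddCommGroup E] [NormedSpace ℝ E]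

/-- The complete lift to `E × E` of a vector field on the vector space `E`. -/
def modelCompleteLift (f : E → E) (w : E × E) : E × E :=
  (f w.1, fderiv ℝ f w.1 w.2)

/-- The vertical lift to `E × E` of a vector field on the vector space `E`. -/
def modelVerticalLift (f : E → E) (w : E × E) : E × E :=
  (0, f w.1)

theorem hasFDerivAt_fderiv_apply {f : E → E} {w : E × E} (hf : ContDiffAt ℝ 2 f w.1) :
    HasFDerivAt (fun q : E × E ↦ fderiv ℝ f q.1 q.2)
      ((fderiv ℝ f w.1).comp (ContinuousLinearMap.snd ℝ E E) +
        ((fderiv ℝ (fderiv ℝ f) w.1).comp (ContinuousLinearMap.fst ℝ E E)).flip w.2) w := by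
  have h : HasFDerivAt (fderiv ℝ f) (fderiv ℝ (fderiv ℝ f) w.1) w.1 :=
    ((hf.fderiv_right (m := 1) (by norm_num)).differentiableAt (by simp)).hasFDerivAt
  have h1 : HasFDerivAt (fun q : E × E ↦ fderiv ℝ f q.1)
      ((fderiv ℝ (fderiv ℝ f) w.1).comp (ContinuousLinearMap.fst ℝ E E)) w :=
    h.comp w hasFDerivAt_fst
  exact h1.clm_apply hasFDerivAt_snd

theorem hasFDerivAt_modelCompleteLift {f : E → E} {w : E × E} (hf : ContDiffAt ℝ 2 f w.1) :
    HasFDerivAt (modelCompleteLift f)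
      (((fderiv ℝ f w.1).comp (ContinuousLinearMap.fst ℝ E E)).prod
        ((fderiv ℝ f w.1).comp (ContinuousLinearMap.snd ℝ E E) +
        ((fderiv ℝ (fderiv ℝ f) w.1).comp (ContinuousLinearMap.fst ℝ E E)).flip w.2)) w :=
  ((hf.differentiableAt (by simp)).hasFDerivAt.comp w hasFDerivAt_fst).prodMk
    (hasFDerivAt_fderiv_apply hf)

theorem hasFDerivAt_modelVerticalLift {f : E → E} {w : E × E} (hf : DifferentiableAt ℝ f w.1) :
    HasFDerivAt (modelVerticalLift f)
      ((0 : E × E →L[ℝ] E).prod ((fderiv ℝ f w.1).comp (ContinuousLinearMap.fst ℝ E E))) w :=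
  (hasFDerivAt_const 0 w).prodMk (hf.hasFDerivAt.comp w hasFDerivAt_fst)

theorem fderiv_fderiv_symm {f : E → E} {z : E} (hf : ContDiffAt ℝ 2 f z) (u v : E) :
    fderiv ℝ (fderiv ℝ f) z u v = fderiv ℝ (fderiv ℝ f) z v u :=
  (hf.isSymmSndFDerivAt (by simp)) u v

theorem hasFDerivAt_lieBracket {f g : E → E} {z : E} (hf : ContDiffAt ℝ 2 f z)
    (hg : ContDiffAt ℝ 2 g z) :
    HasFDerivAt (lieBracket ℝ f g)
      (((fderiv ℝ g z).comp (fderiv ℝ f z) + (fderiv ℝ (fderiv ℝ g) z).flip (f z)) -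
        ((fderiv ℝ f z).comp (fderiv ℝ g z) + (fderiv ℝ (fderiv ℝ f) z).flip (g z))) z := by
  have h {f : E → E} (hf : ContDiffAt ℝ 2 f z) :
      HasFDerivAt (fderiv ℝ f) (fderiv ℝ (fderiv ℝ f) z) z :=
    ((hf.fderiv_right (m := 1) (by norm_num)).differentiableAt (by simp)).hasFDerivAt
  exact ((h hg).clm_apply (hf.differentiableAt (by simp)).hasFDerivAt).sub
    ((h hf).clm_apply (hg.differentiableAt (by simp)).hasFDerivAt)

/-- Both vertical components contain the second derivatives of `f` and `g`, with arguments in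
opposite orders; symmetry of second derivatives makes them agree. -/
theorem lieBracket_modelCompleteLift {f g : E → E} {w : E × E} (hf : ContDiffAt ℝ 2 f w.1)
    (hg : ContDiffAt ℝ 2 g w.1) :
    lieBracket ℝ (modelCompleteLift f) (modelCompleteLift g) w =
      modelCompleteLift (lieBracket ℝ f g) w := by
  rw [lieBracket, (hasFDerivAt_modelCompleteLift hf).fderiv,
    (hasFDerivAt_modelCompleteLift hg).fderiv, modelCompleteLift, modelCompleteLift,
    modelCompleteLift, (hasFDerivAt_lieBracket hf hg).fderiv]
  ext
  · simp [lieBracket]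
  · simp [fderiv_fderiv_symm hf (g w.1), fderiv_fderiv_symm hg (f w.1)]

theorem lieBracket_modelCompleteLift_modelVerticalLift {f g : E → E} {w : E × E}
    (hf : ContDiffAt ℝ 2 f w.1) (hg : DifferentiableAt ℝ g w.1) :
    lieBracket ℝ (modelCompleteLift f) (modelVerticalLift g) w =
      modelVerticalLift (lieBracket ℝ f g) w := by
  rw [lieBracket, (hasFDerivAt_modelCompleteLift hf).fderiv,
    (hasFDerivAt_modelVerticalLift hg).fderiv, modelCompleteLift, modelVerticalLift,
    modelVerticalLift]
  ext <;> simp [lieBracket]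

theorem lieBracket_modelVerticalLift {f g : E → E} {w : E × E}
    (hf : DifferentiableAt ℝ f w.1) (hg : DifferentiableAt ℝ g w.1) :
    lieBracket ℝ (modelVerticalLift f) (modelVerticalLift g) w = 0 := by
  rw [lieBracket, (hasFDerivAt_modelVerticalLift hf).fderiv,
    (hasFDerivAt_modelVerticalLift hg).fderiv, modelVerticalLift, modelVerticalLift]
  ext <;> simp

/-- The complete lift in a vector space is compatible with coordinate changes. -/
theorem fderiv_tangentMap_modelCompleteLift {ψ f g : E → E} {w : E × E}
    (hψ : ContDiffAt ℝ 2 ψ w.1) (hf : DifferentiableAt ℝ f w.1) (hg : DifferentiableAt ℝ g (ψ w.1))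
    (h : ∀ᶠ z in nhds w.1, g (ψ z) = fderiv ℝ ψ z (f z)) :
    fderiv ℝ (fun q : E × E ↦ (ψ q.1, fderiv ℝ ψ q.1 q.2)) w (modelCompleteLift f w) =
      modelCompleteLift g (ψ w.1, fderiv ℝ ψ w.1 w.2) := by
  -- The tangent map of `ψ` has the same formula as the complete lift of `ψ` regarded as a vector
  -- field, so the derivative already computed applies.
  change fderiv ℝ (modelCompleteLift ψ) w _ = _
  rw [(hasFDerivAt_modelCompleteLift hψ).fderiv, modelCompleteLift, modelCompleteLift]
  have h1 : HasFDerivAt (fun z ↦ g (ψ z)) ((fderiv ℝ g (ψ w.1)).comp (fderiv ℝ ψ w.1)) w.1 :=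
    hg.hasFDerivAt.comp w.1 (hψ.differentiableAt (by simp)).hasFDerivAt
  have h2 : HasFDerivAt (fun z ↦ fderiv ℝ ψ z (f z))
      ((fderiv ℝ ψ w.1).comp (fderiv ℝ f w.1) + (fderiv ℝ (fderiv ℝ ψ) w.1).flip (f w.1)) w.1 :=
    ((hψ.fderiv_right (m := 1) (by norm_num)).differentiableAt (by simp)).hasFDerivAt.clm_apply
      hf.hasFDerivAt
  -- Differentiating the relation `g ∘ ψ = Dψ · f` gives the identity for the vertical component, up
  -- to the order of arguments in `D²ψ`.
  have h3 := h1.unique (h2.congr_of_eventuallyEq h)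
  ext
  · simp [h.self_of_nhds]
  · have := congr($h3 w.2)
    simp at this
    simp [this, fderiv_fderiv_symm hψ (f w.1)]

theorem fderiv_tangentMap_modelVerticalLift {ψ f g : E → E} {w : E × E}
    (hψ : ContDiffAt ℝ 2 ψ w.1) (h : g (ψ w.1) = fderiv ℝ ψ w.1 (f w.1)) :
    fderiv ℝ (fun q : E × E ↦ (ψ q.1, fderiv ℝ ψ q.1 q.2)) w (modelVerticalLift f w) =
      modelVerticalLift g (ψ w.1, fderiv ℝ ψ w.1 w.2) := by
  change fderiv ℝ (modelCompleteLift ψ) w _ = _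
  rw [(hasFDerivAt_modelCompleteLift hψ).fderiv, modelVerticalLift, modelVerticalLift]
  ext <;> simp [h]

theorem contDiffAt_modelCompleteLift {f : E → E} {w : E × E} (hf : ContDiffAt ℝ ∞ f w.1) :
    ContDiffAt ℝ ∞ (modelCompleteLift f) w :=
  (hf.comp w contDiffAt_fst).prodMk
    (((hf.fderiv_right (m := ∞) (by simp)).comp w contDiffAt_fst).clm_apply contDiffAt_snd)

theorem contDiffAt_modelVerticalLift {f : E → E} {w : E × E} (hf : ContDiffAt ℝ ∞ f w.1) :
    ContDiffAt ℝ ∞ (modelVerticalLift f) w :=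
  contDiffAt_const.prodMk (hf.comp w contDiffAt_fst)

end Calculus

/-! ### Lifts on a tangent bundle, read in charts -/

section Lifts

variable {E : Type*} [NormedAddCommGroup E] [NormedSpace ℝ E]
  {H : Type*} [TopologicalSpace H] {I : ModelWithCorners ℝ E H}
  {M : Type*} [TopologicalSpace M] [ChartedSpace H M]

/-- The coordinate expression of a vector field in the preferred chart at `x₀`. -/
def chartField (x₀ : M) (X : Π x : M, TangentSpace I x) : E → E :=
  mpullbackWithin 𝓘(ℝ, E) I (extChartAt I x₀).symm X (Set.range I)

theorem mfderiv_extChartAt_eq_tangentCoordChange [IsManifold I 1 M] {x₀ x : M}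
    (hx : x ∈ (extChartAt I x₀).source) :
    mfderiv I 𝓘(ℝ, E) (extChartAt I x₀) x = tangentCoordChange I x x₀ x := by
  rw [extChartAt_source] at hx
  rw [(hasMFDerivAt_extChartAt hx).mfderiv, mfderiv_chartAt_eq_tangentCoordChange hx]

theorem chartField_eq [IsManifold I 1 M] {x₀ : M} {z : E} (hz : z ∈ (extChartAt I x₀).target)
    (X : Π x : M, TangentSpace I x) :
    chartField x₀ X z = tangentCoordChange I ((extChartAt I x₀).symm z) x₀
      ((extChartAt I x₀).symm z) (X ((extChartAt I x₀).symm z)) := by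
  rw [← mfderiv_extChartAt_eq_tangentCoordChange ((extChartAt I x₀).map_target hz), chartField,
    mpullbackWithin_apply, ContinuousLinearMap.inverse_eq
    (mfderivWithin_extChartAt_symm_comp_mfderiv_extChartAt (I := I) hz)
    (mfderiv_extChartAt_comp_mfderivWithin_extChartAt_symm (I := I) hz)]
  rfl

theorem chartField_apply [IsManifold I 1 M] {x₀ x : M} (hx : x ∈ (extChartAt I x₀).source)
    (X : Π x : M, TangentSpace I x) :
    chartField x₀ X (extChartAt I x₀ x) = tangentCoordChange I x x₀ x (X x) := by
  rw [chartField_eq ((extChartAt I x₀).map_source hx)]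
  exact congrArg (fun q ↦ (tangentCoordChange I q x₀ q (X q) : E)) ((extChartAt I x₀).left_inv hx)

theorem extChartAt_tangentBundle_apply [IsManifold I 1 M] (p q : TangentBundle I M) :
    extChartAt I.tangent p q = (extChartAt I p.1 q.1, tangentCoordChange I q.1 p.1 q.1 q.2) :=
  rfl

theorem extChartAt_tangentBundle_source [IsManifold I 1 M] (p : TangentBundle I M) :
    (extChartAt I.tangent p).source = {q | q.1 ∈ (extChartAt I p.1).source} := by
  ext q
  simp

theorem extChartAt_tangentBundle_symm_apply [IsManifold I 1 M] (p : TangentBundle I M) (w : E × E)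
    (hw : w.1 ∈ (extChartAt I p.1).target) :
    (extChartAt I.tangent p).symm w = ⟨(extChartAt I p.1).symm w.1,
      tangentCoordChange I p.1 ((extChartAt I p.1).symm w.1) ((extChartAt I p.1).symm w.1) w.2⟩ := by
  set q : TangentBundle I M := ⟨(extChartAt I p.1).symm w.1,
      tangentCoordChange I p.1 ((extChartAt I p.1).symm w.1) ((extChartAt I p.1).symm w.1) w.2⟩
    with hq
  have hx : (extChartAt I p.1).symm w.1 ∈ (extChartAt I p.1).source :=
    (extChartAt I p.1).map_target hw
  have h : extChartAt I.tangent p q = w := by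
    rw [extChartAt_tangentBundle_apply]
    ext1
    · exact (extChartAt I p.1).right_inv hw
    · simp only [hq]
      rw [tangentCoordChange_comp, tangentCoordChange_self hx]
      exact ⟨⟨hx, mem_extChartAt_source _⟩, hx⟩
  rw [← h, (extChartAt I.tangent p).left_inv]
  rw [extChartAt_tangentBundle_source]
  exact hx

/-- Changes of chart on `TM` are tangent maps of changes of chart on `M`; `modelCompleteLift` serves
here as the formula of a tangent map. -/
theorem extChartAt_comp_symm_tangentBundle [I.Boundaryless] [IsManifold I 1 M]
    {p q : TangentBundle I M} {w : E × E}
    (hw : w.1 ∈ (extChartAt I p.1).target)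
    (hw' : (extChartAt I p.1).symm w.1 ∈ (extChartAt I q.1).source) :
    extChartAt I.tangent q ((extChartAt I.tangent p).symm w) =
      modelCompleteLift (extChartAt I q.1 ∘ (extChartAt I p.1).symm) w := by
  rw [extChartAt_tangentBundle_symm_apply p w hw, extChartAt_tangentBundle_apply, modelCompleteLift]
  ext1
  · rfl
  · simp only []
    rw [tangentCoordChange_comp, tangentCoordChange_def, (extChartAt I p.1).right_inv hw,
      I.range_eq_univ, fderivWithin_univ]
    exact ⟨⟨(extChartAt I p.1).map_target hw, mem_extChartAt_source _⟩, hw'⟩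

theorem coordChange_eventually [I.Boundaryless] {x₀ x : M} (hx : x ∈ (extChartAt I x₀).source) :
    ∀ᶠ z in nhds (extChartAt I x x), z ∈ (extChartAt I x).target ∧
      (extChartAt I x).symm z ∈ (extChartAt I x₀).source := by
  refine Filter.Eventually.and
    ((isOpen_extChartAt_target x).mem_nhds (mem_extChartAt_target x)) ?_
  refine (continuousAt_extChartAt_symm x).preimage_mem_nhds
    ((isOpen_extChartAt_source x₀).mem_nhds ?_)
  rwa [extChartAt_to_inv]

/-- Tangent vectors at `q` are expressed in the preferred chart at `q`, so the derivative of the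
chart at `p` is that of a transition map, taken at the coordinates of `q` in its own chart. -/
theorem mfderiv_extChartAt_tangentBundle [I.Boundaryless] [IsManifold I ∞ M]
    {p q : TangentBundle I M} (hq : q.1 ∈ (extChartAt I p.1).source) :
    mfderiv I.tangent 𝓘(ℝ, E × E) (extChartAt I.tangent p) q =
      fderiv ℝ (modelCompleteLift (extChartAt I p.1 ∘ (extChartAt I q.1).symm))
        (extChartAt I q.1 q.1, q.2) := by
  have hd : MDifferentiableAt I.tangent 𝓘(ℝ, E × E) (extChartAt I.tangent p) q := by
    refine mdifferentiableAt_extChartAt ?_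
    rw [← extChartAt_source I.tangent, extChartAt_tangentBundle_source]
    exact hq
  have hqq : extChartAt I.tangent q q = (extChartAt I q.1 q.1, q.2) := by
    rw [extChartAt_tangentBundle_apply]
    exact Prod.ext rfl (tangentCoordChange_self (E := E) (v := q.2) (mem_extChartAt_source _))
  refine hd.mfderiv.trans ?_
  change fderivWithin ℝ (writtenInExtChartAt I.tangent 𝓘(ℝ, E × E) q (extChartAt I.tangent p))
    (Set.range I.tangent) (extChartAt I.tangent q q) = _
  rw [I.tangent.range_eq_univ, fderivWithin_univ, hqq]
  refine Filter.EventuallyEq.fderiv_eq ?_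
  have := (continuousAt_fst (p := ((extChartAt I q.1 q.1, q.2) : E × E))).eventually
    (coordChange_eventually (I := I) hq)
  filter_upwards [this] with w hw
  exact extChartAt_comp_symm_tangentBundle hw.1 hw.2

theorem contDiffAt_coordChange [I.Boundaryless] [IsManifold I ∞ M] {x₀ x : M}
    (hx : x ∈ (extChartAt I x₀).source) :
    ContDiffAt ℝ ∞ (extChartAt I x₀ ∘ (extChartAt I x).symm) (extChartAt I x x) := by
  have := contDiffWithinAt_ext_coord_change (I := I) (n := ∞) x₀ x (y := extChartAt I x x) ?_
  · rwa [I.range_eq_univ, contDiffWithinAt_univ] at this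
  · rw [PartialEquiv.trans_source'', PartialEquiv.symm_symm, PartialEquiv.symm_target]
    exact Set.mem_image_of_mem _ ⟨mem_extChartAt_source x, hx⟩

theorem contDiffAt_chartField [I.Boundaryless] [IsManifold I ∞ M] {X : Π x : M, TangentSpace I x}
    (hX : CMDiff ∞ (T% X)) {x₀ : M} {z : E} (hz : z ∈ (extChartAt I x₀).target) :
    ContDiffAt ℝ ∞ (chartField x₀ X) z := by
  have hx := (extChartAt I x₀).map_target hz
  have h1 : ContMDiffAt I 𝓘(ℝ, E) ∞ (fun q ↦ tangentCoordChange I q x₀ q (X q))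
      ((extChartAt I x₀).symm z) :=
    ((trivializationAt E (TangentSpace I : M → Type _) x₀).contMDiffAt_section_iff
      (by simpa using hx)).1 (hX _)
  have h2 : ContMDiffAt 𝓘(ℝ, E) I ∞ (extChartAt I x₀).symm z :=
    (contMDiffOn_extChartAt_symm x₀).contMDiffAt ((isOpen_extChartAt_target x₀).mem_nhds hz)
  refine ((h1.comp z h2).congr_of_eventuallyEq ?_).contDiffAt
  filter_upwards [(isOpen_extChartAt_target x₀).mem_nhds hz] with y hy
  exact chartField_eq hy X

/-- The relation holds on a neighbourhood and not only at the point, because the complete lift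
differentiates it. -/
theorem chartField_coordChange [I.Boundaryless] [IsManifold I ∞ M] {x₀ x : M}
    (hx : x ∈ (extChartAt I x₀).source) (X : Π x : M, TangentSpace I x) :
    ∀ᶠ z in nhds (extChartAt I x x),
      chartField x₀ X ((extChartAt I x₀ ∘ (extChartAt I x).symm) z) =
        fderiv ℝ (extChartAt I x₀ ∘ (extChartAt I x).symm) z (chartField x X z) := by
  filter_upwards [coordChange_eventually (I := I) hx] with z hz
  have h := (extChartAt I x).map_target hz.1
  rw [Function.comp_apply, chartField_apply hz.2, chartField_eq hz.1, ← fderivWithin_univ,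
    ← I.range_eq_univ]
  have := tangentCoordChange_def (I := I) (x := x) (y := x₀) (z := (extChartAt I x).symm z)
  rw [(extChartAt I x).right_inv hz.1] at this
  rw [← this]
  exact (tangentCoordChange_comp (E := E) (v := X ((extChartAt I x).symm z))
    ⟨⟨mem_extChartAt_source _, h⟩, hz.2⟩).symm

theorem chartField_self [IsManifold I 1 M] (x : M) (X : Π x : M, TangentSpace I x) :
    chartField x X (extChartAt I x x) = X x :=
  (chartField_apply (mem_extChartAt_source x) X).trans
    (tangentCoordChange_self (E := E) (v := X x) (mem_extChartAt_source x))

theorem completeLift_eq [I.Boundaryless] [IsManifold I ∞ M] (X : Π x : M, TangentSpace I x)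
    (p : TangentBundle I M) :
    completeLift X p = modelCompleteLift (chartField p.1 X) (extChartAt I p.1 p.1, p.2) := by
  refine Prod.ext (chartField_self p.1 X).symm ?_
  change fderivWithin ℝ (chartField p.1 X) (Set.range I) (extChartAt I p.1 p.1) p.2 =
    fderiv ℝ (chartField p.1 X) (extChartAt I p.1 p.1) p.2
  rw [I.range_eq_univ, fderivWithin_univ]

theorem verticalLift_eq_mk [I.Boundaryless] [IsManifold I ∞ M] (X : Π x : M, TangentSpace I x)
    (p : TangentBundle I M) :
    verticalLift X p = ((0, X p.1) : E × E) := by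
  obtain ⟨x, v⟩ := p
  let u : E := X x
  let v' : E := v
  -- In the preferred trivialization at `x` the fibre over `x` is identified with `E` by the
  -- identity, so the curve is affine.
  have hw (t : ℝ) : (trivializationAt E (TangentSpace I : M → Type _) x
      (⟨x, v + t • X x⟩ : TangentBundle I M)).2 = v' + t • u :=
    tangentCoordChange_self (E := E) (v := v' + t • u) (mem_extChartAt_source x)
  have hc : HasFDerivAt (fun t : ℝ ↦ v' + t • u) (ContinuousLinearMap.toSpanSingleton ℝ u) 0 :=
    (ContinuousLinearMap.toSpanSingleton ℝ u).hasFDerivAt.const_add v'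
  have hd : MDifferentiableAt 𝓘(ℝ, ℝ) I.tangent
      (fun t : ℝ ↦ (⟨x, v + t • X x⟩ : TangentBundle I M)) 0 := by
    refine (mdifferentiableAt_totalSpace (F := E) I _).2 ⟨mdifferentiableAt_const, ?_⟩
    simp only [hw]
    exact hc.differentiableAt.mdifferentiableAt
  have h : mfderiv 𝓘(ℝ, ℝ) I.tangent
      (fun t : ℝ ↦ (⟨x, v + t • X x⟩ : TangentBundle I M)) 0 =
      fderiv ℝ (fun t : ℝ ↦ (extChartAt I x x, v' + t • u)) 0 := by
    refine hd.mfderiv.trans ?_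
    change fderivWithin ℝ _ (Set.range 𝓘(ℝ, ℝ)) (0 : ℝ) = _
    rw [ModelWithCorners.range_eq_univ, fderivWithin_univ]
    congr 1
    ext1 t
    exact Prod.ext rfl (hw t)
  rw [verticalLift, h, ((hasFDerivAt_const (extChartAt I x x) (0 : ℝ)).prodMk hc).fderiv]
  exact Prod.ext rfl (one_smul ℝ u)

theorem verticalLift_eq [I.Boundaryless] [IsManifold I ∞ M] (X : Π x : M, TangentSpace I x)
    (p : TangentBundle I M) :
    verticalLift X p = modelVerticalLift (chartField p.1 X) (extChartAt I p.1 p.1, p.2) :=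
  (verticalLift_eq_mk X p).trans (Prod.ext rfl (chartField_self p.1 X).symm)

theorem extChartAt_tangentBundle_eq_modelCompleteLift [I.Boundaryless] [IsManifold I 1 M]
    (p q : TangentBundle I M) :
    extChartAt I.tangent p q = modelCompleteLift (extChartAt I p.1 ∘ (extChartAt I q.1).symm)
      (extChartAt I q.1 q.1, q.2) := by
  rw [extChartAt_tangentBundle_apply, modelCompleteLift]
  refine Prod.ext ?_ ?_
  · simp
  · simp only [tangentCoordChange_def, I.range_eq_univ, fderivWithin_univ]

/-- The definition uses a chart that moves with the point. Compatibility with coordinate changes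
shows that one fixed chart at `p` gives the same formula at every `q` over its domain. -/
theorem mfderiv_extChartAt_completeLift [I.Boundaryless] [IsManifold I ∞ M]
    {X : Π x : M, TangentSpace I x} (hX : CMDiff ∞ (T% X)) {p q : TangentBundle I M}
    (hq : q.1 ∈ (extChartAt I p.1).source) :
    mfderiv I.tangent 𝓘(ℝ, E × E) (extChartAt I.tangent p) q (completeLift X q) =
      modelCompleteLift (chartField p.1 X) (extChartAt I.tangent p q) := by
  rw [mfderiv_extChartAt_tangentBundle hq, completeLift_eq,
    extChartAt_tangentBundle_eq_modelCompleteLift]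
  have h := (chartField_coordChange hq X)
  refine fderiv_tangentMap_modelCompleteLift (w := (extChartAt I q.1 q.1, q.2))
    ((contDiffAt_coordChange hq).of_le ENat.LEInfty.out)
    ((contDiffAt_chartField hX (mem_extChartAt_target q.1)).differentiableAt (by simp))
    ((contDiffAt_chartField hX ?_).differentiableAt (by simp)) h
  rw [Function.comp_apply, extChartAt_to_inv]
  exact (extChartAt I p.1).map_source hq

theorem mfderiv_extChartAt_verticalLift [I.Boundaryless] [IsManifold I ∞ M]
    (X : Π x : M, TangentSpace I x) {p q : TangentBundle I M}
    (hq : q.1 ∈ (extChartAt I p.1).source) :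
    mfderiv I.tangent 𝓘(ℝ, E × E) (extChartAt I.tangent p) q (verticalLift X q) =
      modelVerticalLift (chartField p.1 X) (extChartAt I.tangent p q) := by
  rw [mfderiv_extChartAt_tangentBundle hq, verticalLift_eq,
    extChartAt_tangentBundle_eq_modelCompleteLift]
  exact fderiv_tangentMap_modelVerticalLift (w := (extChartAt I q.1 q.1, q.2))
    ((contDiffAt_coordChange hq).of_le ENat.LEInfty.out) (chartField_coordChange hq X).self_of_nhds

/-- A description in a single chart near `p` is what smoothness and brackets at `p` require. -/
theorem completeLift_eventuallyEq_mpullback [I.Boundaryless] [IsManifold I ∞ M]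
    {X : Π x : M, TangentSpace I x} (hX : CMDiff ∞ (T% X)) (p : TangentBundle I M) :
    completeLift X =ᶠ[nhds p] mpullback I.tangent 𝓘(ℝ, E × E) (extChartAt I.tangent p)
      (modelCompleteLift (chartField p.1 X)) := by
  filter_upwards [extChartAt_source_mem_nhds (I := I.tangent) p] with q hq
  exact ((isInvertible_mfderiv_extChartAt hq).inverse_apply_self _).symm.trans (congrArg _
    (mfderiv_extChartAt_completeLift hX (by rwa [extChartAt_tangentBundle_source] at hq)))

theorem verticalLift_eventuallyEq_mpullback [I.Boundaryless] [IsManifold I ∞ M]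
    (X : Π x : M, TangentSpace I x) (p : TangentBundle I M) :
    verticalLift X =ᶠ[nhds p] mpullback I.tangent 𝓘(ℝ, E × E) (extChartAt I.tangent p)
      (modelVerticalLift (chartField p.1 X)) := by
  filter_upwards [extChartAt_source_mem_nhds (I := I.tangent) p] with q hq
  exact ((isInvertible_mfderiv_extChartAt hq).inverse_apply_self _).symm.trans (congrArg _
    (mfderiv_extChartAt_verticalLift X (by rwa [extChartAt_tangentBundle_source] at hq)))

theorem contMDiff_completeLift [CompleteSpace E] [I.Boundaryless] [IsManifold I ∞ M]
    {X : Π x : M, TangentSpace I x} (hX : CMDiff ∞ (T% X)) :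
    ContMDiff I.tangent I.tangent.tangent ∞ (fun p : TangentBundle I M ↦
      (⟨p, completeLift X p⟩ : TangentBundle I.tangent (TangentBundle I M))) := by
  intro p
  have h := ContMDiffAt.mpullback_vectorField_preimage (I := I.tangent) (I' := 𝓘(ℝ, E × E))
    (n := ∞) (m := ∞)
    (f := extChartAt I.tangent p) (x₀ := p) (V := modelCompleteLift (chartField p.1 X)) ?_
    contMDiffAt_extChartAt (isInvertible_mfderiv_extChartAt (mem_extChartAt_source p)) (by simp)
  · refine h.congr_of_eventuallyEq ?_
    filter_upwards [completeLift_eventuallyEq_mpullback hX p] with q hq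
    rw [hq]
  · exact contMDiffAt_vectorSpace_iff_contDiffAt.2
      (contDiffAt_modelCompleteLift (contDiffAt_chartField hX (mem_extChartAt_target p.1)))

theorem contMDiff_verticalLift [CompleteSpace E] [I.Boundaryless] [IsManifold I ∞ M]
    {X : Π x : M, TangentSpace I x} (hX : CMDiff ∞ (T% X)) :
    ContMDiff I.tangent I.tangent.tangent ∞ (fun p : TangentBundle I M ↦
      (⟨p, verticalLift X p⟩ : TangentBundle I.tangent (TangentBundle I M))) := by
  intro p
  have h := ContMDiffAt.mpullback_vectorField_preimage (I := I.tangent) (I' := 𝓘(ℝ, E × E))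
    (n := ∞) (m := ∞)
    (f := extChartAt I.tangent p) (x₀ := p) (V := modelVerticalLift (chartField p.1 X)) ?_
    contMDiffAt_extChartAt (isInvertible_mfderiv_extChartAt (mem_extChartAt_source p)) (by simp)
  · refine h.congr_of_eventuallyEq ?_
    filter_upwards [verticalLift_eventuallyEq_mpullback X p] with q hq
    rw [hq]
  · exact contMDiffAt_vectorSpace_iff_contDiffAt.2
      (contDiffAt_modelVerticalLift (contDiffAt_chartField hX (mem_extChartAt_target p.1)))

theorem mlieBracket_eq_lieBracket (V W : E → E) :
    mlieBracket 𝓘(ℝ, E) V W = lieBracket ℝ V W := by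
  exact (mlieBracketWithin_univ (I := 𝓘(ℝ, E)) (V := V) (W := W)).symm.trans
    (mlieBracketWithin_eq_lieBracketWithin.trans lieBracketWithin_univ)

/-- Naturality of the Lie bracket under pullback by the inverse chart. -/
theorem chartField_mlieBracket [CompleteSpace E] [I.Boundaryless] [IsManifold I ∞ M]
    {X Y : Π x : M, TangentSpace I x} (hX : CMDiff ∞ (T% X)) (hY : CMDiff ∞ (T% Y)) {x₀ : M} {z : E}
    (hz : z ∈ (extChartAt I x₀).target) :
    chartField x₀ (mlieBracket I X Y) z =
      lieBracket ℝ (chartField x₀ X) (chartField x₀ Y) z := by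
  have h2 : ContMDiffAt 𝓘(ℝ, E) I ∞ (extChartAt I x₀).symm z :=
    (contMDiffOn_extChartAt_symm x₀).contMDiffAt ((isOpen_extChartAt_target x₀).mem_nhds hz)
  have : IsManifold I (minSmoothness ℝ 2) M := by
    rw [minSmoothness_of_isRCLikeNormedField]
    infer_instance
  have h := mpullback_mlieBracket (I := 𝓘(ℝ, E)) (I' := I) (n := ∞)
    (f := (extChartAt I x₀).symm) (x₀ := z)
    ((hX _).mdifferentiableAt (by simp)) ((hY _).mdifferentiableAt (by simp)) h2
    (by simpa using ENat.LEInfty.out)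
  have h := h.trans (congrFun (mlieBracket_eq_lieBracket (E := E) _ _) z)
  simpa only [chartField, I.range_eq_univ, mpullbackWithin_univ] using! h

/-- The bracket of two vector fields on `TM` computed in a chart. -/
theorem mlieBracket_eq_mpullback [CompleteSpace E] [I.Boundaryless] [IsManifold I ∞ M]
    {p : TangentBundle I M} {V W : Π p : TangentBundle I M, TangentSpace I.tangent p}
    {v w : E × E → E × E}
    (hV : V =ᶠ[nhds p] mpullback I.tangent 𝓘(ℝ, E × E) (extChartAt I.tangent p) v)
    (hW : W =ᶠ[nhds p] mpullback I.tangent 𝓘(ℝ, E × E) (extChartAt I.tangent p) w)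
    (hv : ContDiffAt ℝ ∞ v (extChartAt I.tangent p p))
    (hw : ContDiffAt ℝ ∞ w (extChartAt I.tangent p p)) :
    mlieBracket I.tangent V W p =
      mpullback I.tangent 𝓘(ℝ, E × E) (extChartAt I.tangent p) (lieBracket ℝ v w) p := by
  have : IsManifold I.tangent (minSmoothness ℝ 2) (TangentBundle I M) := by
    rw [minSmoothness_of_isRCLikeNormedField]
    infer_instance
  have : IsManifold 𝓘(ℝ, E × E) (minSmoothness ℝ 2) (E × E) := by
    rw [minSmoothness_of_isRCLikeNormedField]
    infer_instance
  rw [hV.mlieBracket_vectorField_eq hW]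
  refine (mpullback_mlieBracket (n := ∞)
    ((contMDiffAt_vectorSpace_iff_contDiffAt.2 hv).mdifferentiableAt (by simp))
    ((contMDiffAt_vectorSpace_iff_contDiffAt.2 hw).mdifferentiableAt (by simp))
    contMDiffAt_extChartAt (by simpa using ENat.LEInfty.out)).symm.trans ?_
  exact congrArg (fun u ↦ mpullback I.tangent 𝓘(ℝ, E × E) (extChartAt I.tangent p) u p)
    (mlieBracket_eq_lieBracket v w)

section Bracket

variable [CompleteSpace E] [I.Boundaryless] [IsManifold I ∞ M]
  {X Y : Π x : M, TangentSpace I x} (hX : CMDiff ∞ (T% X)) (hY : CMDiff ∞ (T% Y))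
  (p : TangentBundle I M)

include hX hY

theorem mlieBracket_completeLift (hXY : CMDiff ∞ (T% (mlieBracket I X Y))) :
    mlieBracket I.tangent (completeLift X) (completeLift Y) p =
      completeLift (mlieBracket I X Y) p := by
  have hp := mem_extChartAt_target (I := I) p.1
  have hX' := contDiffAt_chartField hX hp
  have hY' := contDiffAt_chartField hY hp
  rw [mlieBracket_eq_mpullback (completeLift_eventuallyEq_mpullback hX p)
    (completeLift_eventuallyEq_mpullback hY p) (contDiffAt_modelCompleteLift hX')
    (contDiffAt_modelCompleteLift hY'),
    (completeLift_eventuallyEq_mpullback hXY p).self_of_nhds]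
  refine congrArg (mfderiv I.tangent 𝓘(ℝ, E × E) (extChartAt I.tangent p) p).inverse ?_
  refine (lieBracket_modelCompleteLift (w := extChartAt I.tangent p p)
    (hX'.of_le ENat.LEInfty.out) (hY'.of_le ENat.LEInfty.out)).trans ?_
  -- Equality near the point is needed, since the vertical component of the complete lift involves
  -- the derivative of the coordinate field.
  have h : chartField p.1 (mlieBracket I X Y) =ᶠ[nhds (extChartAt I p.1 p.1)]
      lieBracket ℝ (chartField p.1 X) (chartField p.1 Y) := by
    filter_upwards [(isOpen_extChartAt_target p.1).mem_nhds hp] with z hz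
    exact chartField_mlieBracket hX hY hz
  exact Prod.ext h.self_of_nhds.symm congr($(h.fderiv_eq.symm) _)

theorem mlieBracket_completeLift_verticalLift :
    mlieBracket I.tangent (completeLift X) (verticalLift Y) p =
      verticalLift (mlieBracket I X Y) p := by
  have hp := mem_extChartAt_target (I := I) p.1
  have hX' := contDiffAt_chartField hX hp
  have hY' := contDiffAt_chartField hY hp
  rw [mlieBracket_eq_mpullback (completeLift_eventuallyEq_mpullback hX p)
    (verticalLift_eventuallyEq_mpullback Y p) (contDiffAt_modelCompleteLift hX')
    (contDiffAt_modelVerticalLift hY'),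
    (verticalLift_eventuallyEq_mpullback _ p).self_of_nhds]
  refine congrArg (mfderiv I.tangent 𝓘(ℝ, E × E) (extChartAt I.tangent p) p).inverse ?_
  refine (lieBracket_modelCompleteLift_modelVerticalLift (w := extChartAt I.tangent p p)
    (hX'.of_le ENat.LEInfty.out) (hY'.differentiableAt (by simp))).trans ?_
  exact Prod.ext rfl (chartField_mlieBracket hX hY hp).symm

theorem mlieBracket_verticalLift :
    mlieBracket I.tangent (verticalLift X) (verticalLift Y) p = 0 := by
  have hp := mem_extChartAt_target (I := I) p.1
  have hX' := contDiffAt_chartField hX hp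
  have hY' := contDiffAt_chartField hY hp
  rw [mlieBracket_eq_mpullback (verticalLift_eventuallyEq_mpullback X p)
    (verticalLift_eventuallyEq_mpullback Y p) (contDiffAt_modelVerticalLift hX')
    (contDiffAt_modelVerticalLift hY')]
  refine (congrArg (mfderiv I.tangent 𝓘(ℝ, E × E) (extChartAt I.tangent p) p).inverse
    (lieBracket_modelVerticalLift (w := extChartAt I.tangent p p)
    (hX'.differentiableAt (by simp)) (hY'.differentiableAt (by simp)))).trans (map_zero _)

end Bracket

end Lifts

/-! ### Left invariant fields and metrics -/

section LieGroup

variable {E : Type*} [NormedAddCommGroup E] [NormedSpace ℝ E]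
  {H : Type*} [TopologicalSpace H] {I : ModelWithCorners ℝ E H}
  {G : Type*} [TopologicalSpace G] [ChartedSpace H G] [Group G] [LieGroup I ∞ G]

/-- The field is the tangent map of multiplication applied to the pair formed by the zero vector at
`g` and `v` at `1`, hence a composite of smooth maps. -/
theorem contMDiff_mulInvariantVectorField_infty (v : GroupLieAlgebra I G) :
    ContMDiff I I.tangent ∞
      (fun g : G ↦ (⟨g, mulInvariantVectorField v g⟩ : TangentBundle I G)) := by
  let fg : G → TangentBundle I G := fun g ↦ TotalSpace.mk' E g 0
  have sfg : ContMDiff I I.tangent ∞ fg := contMDiff_zeroSection _ _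
  let fv : G → TangentBundle I G := fun _ ↦ TotalSpace.mk' E 1 v
  have sfv : ContMDiff I I.tangent ∞ fv := contMDiff_const
  let F₁ : G → (TangentBundle I G × TangentBundle I G) := fun g ↦ (fg g, fv g)
  have S₁ : ContMDiff I (I.tangent.prod I.tangent) ∞ F₁ := sfg.prodMk sfv
  let F₂ : (TangentBundle I G × TangentBundle I G) → TangentBundle (I.prod I) (G × G) :=
    (equivTangentBundleProd I G I G).symm
  have S₂ : ContMDiff (I.tangent.prod I.tangent) (I.prod I).tangent ∞ F₂ :=
    contMDiff_equivTangentBundleProd_symm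
  let F₃ : TangentBundle (I.prod I) (G × G) → TangentBundle I G :=
    tangentMap (I.prod I) I (fun (p : G × G) ↦ p.1 * p.2)
  have S₃ : ContMDiff (I.prod I).tangent I.tangent ∞ F₃ :=
    (contMDiff_mul I ∞).contMDiff_tangentMap (m := ∞) (by simp)
  have S := (S₃.comp S₂).comp S₁
  convert! S with g
  · simp [F₁, F₂, F₃, fg, fv]
  · simp only [Function.comp_apply, tangentMap, F₃, F₂, F₁, fg, fv]
    rw [mfderiv_prod_eq_add_apply ((contMDiff_mul I ∞).mdifferentiable (by simp) _)]
    exact ((congrArg (· + _) (map_zero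
      (mfderiv I I (fun h : G ↦ h * (1 : G)) g : E →L[ℝ] E))).trans (zero_add _)).symm

theorem lieGroup_minSmoothness : LieGroup I (minSmoothness ℝ 3) G := by
  rw [minSmoothness_of_isRCLikeNormedField]
  exact LieGroup.of_le (n := ∞) ENat.LEInfty.out

theorem mlieBracket_mulInvariantVectorField [CompleteSpace E] (u v : GroupLieAlgebra I G) :
    mlieBracket I (mulInvariantVectorField u) (mulInvariantVectorField v) =
      mulInvariantVectorField ⁅u, v⁆ :=
  have := lieGroup_minSmoothness (I := I) (G := G)
  (mulInvariantVector_mlieBracket u v).symm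

theorem mulInvariantVectorField_injective (x : G) {u : GroupLieAlgebra I G}
    (h : mulInvariantVectorField u x = 0) : u = 0 := by
  have hd (a b : G) : MDifferentiableAt I I (fun y ↦ a * y) b :=
    (contMDiff_mul_left (I := I) (n := ∞)).mdifferentiable (by simp) b
  have h1 : mfderiv I I ((fun y ↦ x⁻¹ * y) ∘ (fun y ↦ x * y)) 1 =
      ContinuousLinearMap.id ℝ (TangentSpace I (1 : G)) := by
    have : (fun y ↦ x⁻¹ * y) ∘ (fun y ↦ x * y) = id := by ext y; simp
    rw [this, mfderiv_id]
  rw [mfderiv_comp (I' := I) _ (hd _ _) (hd _ _)] at h1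
  have h2 := congr($h1 u)
  rw [ContinuousLinearMap.comp_apply] at h2
  exact h2.symm.trans ((congrArg _ h).trans (map_zero _))

theorem IsLeftInvariant.inner_mulInvariantVectorField {g : Metric I G} (hg : IsLeftInvariant g)
    (x : G) (u v : GroupLieAlgebra I G) :
    g.inner x (mulInvariantVectorField u x) (mulInvariantVectorField v x) = g.inner 1 u v := by
  rw [← hg x 1 u v]
  -- `x * 1` and `x` are not definitionally equal, but every tangent space is the model `E`, so the
  -- form can be transported with vectors held fixed in `E`.
  have key (b : G) (hb : b = x) (w w' : E) :
      (g.inner x : E →L[ℝ] E →L[ℝ] ℝ) w w' = (g.inner b : E →L[ℝ] E →L[ℝ] ℝ) w w' := by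
    rw [hb]
  exact key (x * 1) (mul_one x) _ _

end LieGroup

/-! ### Linearity of the complete lift -/

section Linear

variable {E : Type*} [NormedAddCommGroup E] [NormedSpace ℝ E]
  {H : Type*} [TopologicalSpace H] {I : ModelWithCorners ℝ E H}
  {M : Type*} [TopologicalSpace M] [ChartedSpace H M] [I.Boundaryless] [IsManifold I ∞ M]
  {X Y : Π x : M, TangentSpace I x}

theorem completeLift_add (hX : CMDiff ∞ (T% X)) (hY : CMDiff ∞ (T% Y)) (p : TangentBundle I M) :
    completeLift (X + Y) p = completeLift X p + completeLift Y p := by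
  have hp := mem_extChartAt_target (I := I) p.1
  rw [completeLift_eq, completeLift_eq, completeLift_eq]
  have h : chartField p.1 (X + Y) = chartField p.1 X + chartField p.1 Y := mpullbackWithin_add
  rw [h]
  refine Prod.ext rfl ?_
  change fderiv ℝ _ _ _ = fderiv ℝ _ _ _ + fderiv ℝ _ _ _
  rw [fderiv_add ((contDiffAt_chartField hX hp).differentiableAt (by simp))
    ((contDiffAt_chartField hY hp).differentiableAt (by simp))]
  rfl

theorem completeLift_smul (hX : CMDiff ∞ (T% X)) (c : ℝ) (p : TangentBundle I M) :
    completeLift (c • X) p = c • completeLift X p := by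
  have hp := mem_extChartAt_target (I := I) p.1
  rw [completeLift_eq, completeLift_eq]
  have h : chartField p.1 (c • X) = c • chartField p.1 X := mpullbackWithin_const_smul
  rw [h]
  refine Prod.ext rfl ?_
  change fderiv ℝ _ _ _ = c • fderiv ℝ _ _ _
  rw [fderiv_const_smul ((contDiffAt_chartField hX hp).differentiableAt (by simp))]
  rfl

end Linear

/-! ### The global frame of lifted invariant fields -/

section LiftFrame

variable {E : Type*} [NormedAddCommGroup E] [NormedSpace ℝ E]
  {H : Type*} [TopologicalSpace H] {I : ModelWithCorners ℝ E H} [I.Boundaryless]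
  {G : Type*} [TopologicalSpace G] [ChartedSpace H G] [Group G] [LieGroup I ∞ G]

/-- The complete lift of a left invariant vector field at a point, as a linear map. -/
def invariantCompleteLift (p : TangentBundle I G) :
    GroupLieAlgebra I G →ₗ[ℝ] TangentSpace I.tangent p where
  toFun u := completeLift (mulInvariantVectorField u) p
  map_add' u v := by
    rw [mulInvariantVectorField_add, completeLift_add
      (contMDiff_mulInvariantVectorField_infty u) (contMDiff_mulInvariantVectorField_infty v)]
  map_smul' c u := by
    rw [mulInvariantVectorField_smul, completeLift_smul (contMDiff_mulInvariantVectorField_infty u)]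
    rfl

/-- The vertical lift of a left invariant vector field at a point, as a linear map. -/
def invariantVerticalLift (p : TangentBundle I G) :
    GroupLieAlgebra I G →ₗ[ℝ] TangentSpace I.tangent p where
  toFun u := verticalLift (mulInvariantVectorField u) p
  map_add' u v := by
    rw [verticalLift_eq_mk, verticalLift_eq_mk, verticalLift_eq_mk, mulInvariantVectorField_add]
    exact Prod.ext (add_zero (0 : E)).symm rfl
  map_smul' c u := by
    rw [verticalLift_eq_mk, verticalLift_eq_mk, mulInvariantVectorField_smul]
    exact Prod.ext (smul_zero (A := E) c).symm rfl

/-- The system is triangular: vertical lifts have no horizontal component, so the horizontal part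
gives `v = 0`, and then the vertical part gives `u = 0`. -/
theorem eq_zero_of_lift_add_eq_zero {p : TangentBundle I G} {u v : GroupLieAlgebra I G}
    (h : invariantVerticalLift p u + invariantCompleteLift p v = 0) : u = 0 ∧ v = 0 := by
  have hV : invariantVerticalLift p u = ((0, mulInvariantVectorField u p.1) : E × E) :=
    verticalLift_eq_mk _ _
  have hv : v = 0 := by
    refine mulInvariantVectorField_injective p.1 ?_
    have h1 := congrArg (fun w : E × E ↦ w.1) h
    rw [hV] at h1
    exact (zero_add (M := E) _).symm.trans h1
  subst hv
  refine ⟨mulInvariantVectorField_injective p.1 ?_, rfl⟩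
  rw [map_zero, add_zero] at h
  exact congrArg (fun w : E × E ↦ w.2) (hV.symm.trans h)

variable {n : ℕ} (X : Module.Basis (Fin n) ℝ (GroupLieAlgebra I G)) (lam : Fin n → ℝ)

/-- The frame of `TG` given by the normalized vertical lifts and the complete lifts. -/
def liftFrame : Fin n ⊕ Fin n → Π p : TangentBundle I G, TangentSpace I.tangent p :=
  Sum.elim (frameV X lam) (frameC X)

theorem isLocalFrameOn_liftFrame [FiniteDimensional ℝ E] (hlam : ∀ i, 0 < lam i) :
    IsLocalFrameOn I.tangent (E × E) ∞ (liftFrame X lam) Set.univ := by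
  have hs (i : Fin n) : 1 / √(lam i) ≠ 0 := (one_div_pos.2 (Real.sqrt_pos.2 (hlam i))).ne'
  have hli (p : TangentBundle I G) : LinearIndependent ℝ (liftFrame X lam · p) := by
    rw [Fintype.linearIndependent_iff]
    intro a ha
    rw [Fintype.sum_sum_type] at ha
    -- A relation among the frame vectors is collected into one vertical and one complete lift of
    -- Lie algebra elements, which then vanish separately.
    have hu : invariantVerticalLift p (∑ i, (a (.inl i) * (1 / √(lam i))) • X i) =
        ∑ i, a (.inl i) • liftFrame X lam (.inl i) p := by
      rw [map_sum]
      refine Finset.sum_congr rfl fun i _ ↦ ?_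
      rw [map_smul, mul_smul]
      rfl
    have hv : invariantCompleteLift p (∑ i, a (.inr i) • X i) =
        ∑ i, a (.inr i) • liftFrame X lam (.inr i) p := by
      rw [map_sum]
      refine Finset.sum_congr rfl fun i _ ↦ ?_
      rw [map_smul]
      rfl
    rw [← hu, ← hv] at ha
    obtain ⟨h1, h2⟩ := eq_zero_of_lift_add_eq_zero ha
    have hX := Fintype.linearIndependent_iff.1 X.linearIndependent
    rintro (i | i)
    · exact (mul_eq_zero.1 (hX _ h1 i)).resolve_right (hs i)
    · exact hX _ h2 i
  refine ⟨fun {p} _ ↦ hli p, fun {p} _ ↦ ?_, fun i ↦ ?_⟩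
  · refine ((hli p).span_eq_top_of_card_eq_finrank' ?_).ge
    have hE : Module.finrank ℝ E = n := by
      have := Module.finrank_eq_card_basis X
      rwa [Fintype.card_fin] at this
    have : Module.finrank ℝ (E × E) = n + n := by rw [Module.finrank_prod, hE]
    rw [Fintype.card_sum, Fintype.card_fin]
    exact this.symm
  · have : CompleteSpace E := FiniteDimensional.complete ℝ E
    rw [contMDiffOn_univ]
    rcases i with i | i
    · exact (contMDiff_verticalLift
        (contMDiff_mulInvariantVectorField_infty (X i))).const_smul_section
    · exact contMDiff_completeLift (contMDiff_mulInvariantVectorField_infty (X i))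

end LiftFrame

/-! ### Brackets of the frame fields -/

section Bracket

variable {E : Type*} [NormedAddCommGroup E] [NormedSpace ℝ E]
  {H : Type*} [TopologicalSpace H] {I : ModelWithCorners ℝ E H} [I.Boundaryless]
  {G : Type*} [TopologicalSpace G] [ChartedSpace H G] [Group G] [LieGroup I ∞ G]
  {n : ℕ} (X : Module.Basis (Fin n) ℝ (GroupLieAlgebra I G)) {lam : Fin n → ℝ}

theorem completeLift_eq_sum_frameC (u : GroupLieAlgebra I G) (p : TangentBundle I G) :
    completeLift (mulInvariantVectorField u) p = ∑ k, X.repr u k • frameC X k p := by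
  change invariantCompleteLift p u = _
  conv_lhs => rw [← X.sum_repr u, map_sum]
  refine Finset.sum_congr rfl fun k _ ↦ ?_
  rw [map_smul]
  rfl

theorem verticalLift_eq_sum_frameV (hlam : ∀ i, 0 < lam i) (u : GroupLieAlgebra I G)
    (p : TangentBundle I G) :
    verticalLift (mulInvariantVectorField u) p =
      ∑ k, (√(lam k) * X.repr u k) • frameV X lam k p := by
  change invariantVerticalLift p u = _
  conv_lhs => rw [← X.sum_repr u, map_sum]
  refine Finset.sum_congr rfl fun k _ ↦ ?_
  have h := (Real.sqrt_pos.2 (hlam k)).ne'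
  rw [map_smul, frameV, smul_smul, show √(lam k) * X.repr u k * (1 / √(lam k)) = X.repr u k by
    field_simp]
  rfl

omit [I.Boundaryless] [LieGroup I ∞ G] in
theorem structureConst_swap (i j k : Fin n) :
    structureConst X i j k = -structureConst X j i k := by
  rw [structureConst, structureConst, GroupLieAlgebra.bracket_def, GroupLieAlgebra.bracket_def,
    mlieBracket_swap_apply, map_neg]
  rfl

theorem mdifferentiableAt_verticalLift (u : GroupLieAlgebra I G) [CompleteSpace E]
    (p : TangentBundle I G) :
    MDiffAt (T% (verticalLift (mulInvariantVectorField u))) p :=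
  (contMDiff_verticalLift (contMDiff_mulInvariantVectorField_infty u)).mdifferentiable (by simp) p

variable [CompleteSpace E]

theorem mlieBracket_frameC (i j : Fin n) (p : TangentBundle I G) :
    mlieBracket I.tangent (frameC X i) (frameC X j) p =
      ∑ k, structureConst X i j k • frameC X k p := by
  refine (mlieBracket_completeLift (contMDiff_mulInvariantVectorField_infty (X i))
    (contMDiff_mulInvariantVectorField_infty (X j)) p ?_).trans ?_
  · rw [mlieBracket_mulInvariantVectorField]
    exact contMDiff_mulInvariantVectorField_infty _
  · rw [mlieBracket_mulInvariantVectorField]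
    exact completeLift_eq_sum_frameC X _ p

/-- The factor `1 / √λ_j` comes from normalizing the second field, and `√λ_k` from expanding `[X_i,
X_j]^v` in the normalized frame. -/
theorem mlieBracket_frameC_frameV (hlam : ∀ i, 0 < lam i) (i j : Fin n) (p : TangentBundle I G) :
    mlieBracket I.tangent (frameC X i) (frameV X lam j) p =
      ∑ k, (√(lam k) / √(lam j) * structureConst X i j k) • frameV X lam k p := by
  refine (mlieBracket_const_smul_right (c := 1 / √(lam j)) (V := frameC X i)
    (mdifferentiableAt_verticalLift (X j) p)).trans ?_
  have h := mlieBracket_completeLift_verticalLift (contMDiff_mulInvariantVectorField_infty (X i))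
    (contMDiff_mulInvariantVectorField_infty (X j)) p
  rw [mlieBracket_mulInvariantVectorField] at h
  refine (congrArg (fun w ↦ (1 / √(lam j)) • w)
    (h.trans (verticalLift_eq_sum_frameV X hlam _ p))).trans ?_
  rw [Finset.smul_sum]
  refine Finset.sum_congr rfl fun k _ ↦ ?_
  rw [smul_smul, structureConst]
  congr 1
  ring

theorem mlieBracket_frameV (i j : Fin n) (p : TangentBundle I G) :
    mlieBracket I.tangent (frameV X lam i) (frameV X lam j) p = 0 := by
  refine (mlieBracket_const_smul_right (c := 1 / √(lam j)) (V := frameV X lam i)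
    (mdifferentiableAt_verticalLift (X j) p)).trans ?_
  refine (congrArg (fun w ↦ (1 / √(lam j)) • w)
    ((mlieBracket_const_smul_left (c := 1 / √(lam i))
    (mdifferentiableAt_verticalLift (X i) p)).trans (congrArg (fun w ↦ (1 / √(lam i)) • w)
    (mlieBracket_verticalLift (contMDiff_mulInvariantVectorField_infty (X i))
    (contMDiff_mulInvariantVectorField_infty (X j)) p)))).trans ?_
  rw [smul_zero, smul_zero]

end Bracket

/-! ### Bracket coefficients in the frame -/

section Coeff

variable {E : Type*} [NormedAddCommGroup E] [NormedSpace ℝ E]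
  {H : Type*} [TopologicalSpace H] {I : ModelWithCorners ℝ E H} [I.Boundaryless]
  {G : Type*} [TopologicalSpace G] [ChartedSpace H G] [Group G] [LieGroup I ∞ G]
  {n : ℕ} {X : Module.Basis (Fin n) ℝ (GroupLieAlgebra I G)} {lam : Fin n → ℝ}
  (hF : IsLocalFrameOn I.tangent (E × E) ∞ (liftFrame X lam) Set.univ)
  (p : TangentBundle I G)

omit [I.Boundaryless] in
theorem coeff_sum_frameC (a : Fin n → ℝ) (k : Fin n ⊕ Fin n) :
    hF.coeff k p (∑ l, a l • frameC X l p) = Sum.elim (fun _ ↦ 0) a k := by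
  have h (l : Fin n) : hF.coeff k p (frameC X l p) = if Sum.inr l = k then 1 else 0 :=
    coeff_frame hF p k (.inr l)
  simp only [map_sum, map_smul, h]
  rcases k with k | k <;> simp

omit [I.Boundaryless] in
theorem coeff_sum_frameV (a : Fin n → ℝ) (k : Fin n ⊕ Fin n) :
    hF.coeff k p (∑ l, a l • frameV X lam l p) = Sum.elim a (fun _ ↦ 0) k := by
  have h (l : Fin n) : hF.coeff k p (frameV X lam l p) = if Sum.inl l = k then 1 else 0 :=
    coeff_frame hF p k (.inl l)
  simp only [map_sum, map_smul, h]
  rcases k with k | k <;> simp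

variable [CompleteSpace E]

theorem bracketCoeff_inr_inr (i j : Fin n) (k : Fin n ⊕ Fin n) :
    bracketCoeff hF p (.inr i) (.inr j) k = Sum.elim (fun _ ↦ 0) (structureConst X i j) k :=
  (congrArg _ (mlieBracket_frameC X i j p)).trans (coeff_sum_frameC hF p _ k)

theorem bracketCoeff_inr_inl (hlam : ∀ i, 0 < lam i) (i j : Fin n) (k : Fin n ⊕ Fin n) :
    bracketCoeff hF p (.inr i) (.inl j) k =
      Sum.elim (fun k ↦ √(lam k) / √(lam j) * structureConst X i j k) (fun _ ↦ 0) k :=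
  (congrArg _ (mlieBracket_frameC_frameV X hlam i j p)).trans (coeff_sum_frameV hF p _ k)

theorem bracketCoeff_inl_inr (hlam : ∀ i, 0 < lam i) (i j : Fin n) (k : Fin n ⊕ Fin n) :
    bracketCoeff hF p (.inl i) (.inr j) k =
      Sum.elim (fun k ↦ √(lam k) / √(lam i) * structureConst X i j k) (fun _ ↦ 0) k := by
  rw [bracketCoeff_swap, bracketCoeff_inr_inl hF p hlam]
  rcases k with k | k
  · simp [structureConst_swap X i j]
  · simp

theorem bracketCoeff_inl_inl (i j : Fin n) (k : Fin n ⊕ Fin n) :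
    bracketCoeff hF p (.inl i) (.inl j) k = 0 :=
  (congrArg _ (mlieBracket_frameV X i j p)).trans (map_zero _)

end Coeff

/-! ### Lifted metrics as metrics with an orthonormal frame -/

section Main

variable {E : Type*} [NormedAddCommGroup E] [NormedSpace ℝ E] [FiniteDimensional ℝ E]
  {H : Type*} [TopologicalSpace H] {I : ModelWithCorners ℝ E H} [I.Boundaryless]
  {G : Type*} [TopologicalSpace G] [ChartedSpace H G] [Group G] [LieGroup I ∞ G]
  {g₁ g₂ : Metric I G} {n : ℕ} {X : Module.Basis (Fin n) ℝ (GroupLieAlgebra I G)}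
  {lam : Fin n → ℝ}

omit [I.Boundaryless] in
theorem inner_eq_of_hasEigenvector (hX : ∀ i j, g₁.inner 1 (X i) (X j) = if i = j then 1 else 0)
    (hlam : ∀ i, (comparison g₁ g₂).HasEigenvector (lam i) (X i)) (i j : Fin n) :
    g₂.inner 1 (X i) (X j) = if i = j then lam i else 0 := by
  rw [innerAtOne_comparison g₁ g₂, (hlam i).apply_eq_smul]
  refine ((congrArg (· (X j)) (map_smul (g₁.inner 1) (lam i) (X i))).trans
    (congrArg (lam i • ·) (hX i j))).trans ?_
  simp

omit [I.Boundaryless] in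
theorem eigenvalue_pos (hX : ∀ i j, g₁.inner 1 (X i) (X j) = if i = j then 1 else 0)
    (hlam : ∀ i, (comparison g₁ g₂).HasEigenvector (lam i) (X i)) (i : Fin n) : 0 < lam i := by
  have h := g₂.pos 1 (X i) (X.ne_zero i)
  rw [inner_eq_of_hasEigenvector hX hlam, if_pos rfl] at h
  exact h

/-- Left invariance moves the conditions to the identity, where `X_i` is orthonormal for `g₁` and
orthogonal with squared lengths `λ_i` for `g₂`; dividing the vertical lifts by `√λ_i` normalizes
them. The converse expands arbitrary `u`, `v` in the basis. -/
theorem isLiftedMetric_iff_isOrthonormalFrame (hg₁ : IsLeftInvariant g₁)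
    (hg₂ : IsLeftInvariant g₂)
    (hX : ∀ i j, g₁.inner 1 (X i) (X j) = if i = j then 1 else 0)
    (hlam : ∀ i, (comparison g₁ g₂).HasEigenvector (lam i) (X i))
    (g : Metric I.tangent (TangentBundle I G)) :
    IsLiftedMetric g₁ g₂ g ↔ IsOrthonormalFrame g (liftFrame X lam) := by
  have hpos := eigenvalue_pos hX hlam
  have h₂ := inner_eq_of_hasEigenvector hX hlam
  have hs (i : Fin n) := (Real.sqrt_pos.2 (hpos i)).ne'
  constructor
  · intro h p
    have hCC (i j : Fin n) : g.inner p (frameC X i p) (frameC X j p) = if i = j then 1 else 0 :=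
      (h (X i) (X j) p).1.trans ((hg₁.inner_mulInvariantVectorField _ _ _).trans (hX i j))
    have hVV (i j : Fin n) :
        g.inner p (frameV X lam i p) (frameV X lam j p) = if i = j then 1 else 0 := by
      have := (h (X i) (X j) p).2.1.trans
        ((hg₂.inner_mulInvariantVectorField _ _ _).trans (h₂ i j))
      rw [frameV, frameV, map_smul, map_smul, _root_.smul_apply, this]
      split_ifs with hij
      · subst hij
        have := Real.mul_self_sqrt (hpos i).le
        have := hs i
        simp only [smul_eq_mul]
        field_simp
        nlinarith
      · simp
    have hCV (i j : Fin n) : g.inner p (frameC X i p) (frameV X lam j p) = 0 := by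
      rw [frameV, map_smul]
      exact (congrArg _ (h (X i) (X j) p).2.2).trans (smul_zero _)
    rintro (i | i) (j | j)
    · exact (hVV i j).trans (by simp)
    · refine (g.symm p _ _).trans ((hCV j i).trans ?_)
      simp
    · refine (hCV i j).trans ?_
      simp
    · exact (hCC i j).trans (by simp)
  · intro h u v p
    have hCC (i j : Fin n) : g.inner p (frameC X i p) (frameC X j p) = if i = j then 1 else 0 :=
      (h p (.inr i) (.inr j)).trans (by simp)
    have hVV (i j : Fin n) :
        g.inner p (frameV X lam i p) (frameV X lam j p) = if i = j then 1 else 0 :=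
      (h p (.inl i) (.inl j)).trans (by simp)
    have hCV (i j : Fin n) : g.inner p (frameC X i p) (frameV X lam j p) = 0 :=
      (h p (.inr i) (.inl j)).trans (by simp)
    have expand (g' : Metric I G) : g'.inner 1 u v =
        ∑ i, ∑ j, X.repr u i * X.repr v j * g'.inner 1 (X i) (X j) := by
      change innerAtOne g' u v = ∑ i, ∑ j, X.repr u i * X.repr v j * innerAtOne g' (X i) (X j)
      conv_lhs => rw [← X.sum_repr u, ← X.sum_repr v]
      simp only [map_sum, map_smul, LinearMap.sum_apply, LinearMap.smul_apply, smul_eq_mul,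
        Finset.mul_sum, mul_assoc]
      rw [Finset.sum_comm]
      simp only [mul_left_comm]
    rw [hg₁.inner_mulInvariantVectorField, hg₂.inner_mulInvariantVectorField, expand g₁, expand g₂,
      completeLift_eq_sum_frameC X, completeLift_eq_sum_frameC X,
      verticalLift_eq_sum_frameV X hpos, verticalLift_eq_sum_frameV X hpos]
    simp only [hX, h₂, map_sum, map_smul, _root_.sum_apply, _root_.smul_apply, hCC, hVV, hCV,
      smul_eq_mul, mul_ite, mul_one, mul_zero, Finset.sum_ite_eq, Finset.sum_ite_eq',
      Finset.mem_univ, if_true, Finset.sum_const_zero]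
    refine ⟨Finset.sum_congr rfl fun i _ ↦ by ring, Finset.sum_congr rfl fun i _ ↦ ?_, trivial⟩
    have := Real.mul_self_sqrt (hpos i).le
    linear_combination X.repr u i * X.repr v i * this

end Main

end LiftedMetric

end

/-! ### The theorem -/

open LiftedMetric in
theorem theorem4p1
    {E : Type*} [NormedAddCommGroup E] [NormedSpace ℝ E] [FiniteDimensional ℝ E]
    {H : Type*} [TopologicalSpace H] {I : ModelWithCorners ℝ E H} [I.Boundaryless]
    {G : Type*} [TopologicalSpace G] [ChartedSpace H G] [Group G] [LieGroup I ∞ G]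
    (g₁ g₂ : LiftedMetric.Metric I G) (hg₁ : IsLeftInvariant g₁) (hg₂ : IsLeftInvariant g₂)
    {n : ℕ} (X : Module.Basis (Fin n) ℝ (GroupLieAlgebra I G))
    (hX : ∀ i j, g₁.inner 1 (X i) (X j) = if i = j then 1 else 0)
    (lam : Fin n → ℝ)
    (hlam : ∀ i, (comparison g₁ g₂).HasEigenvector (lam i) (X i)) :
    (∀ i, 0 < lam i) ∧
    (∃! g : LiftedMetric.Metric I.tangent (TangentBundle I G), IsLiftedMetric g₁ g₂ g) ∧
    ∀ g : LiftedMetric.Metric I.tangent (TangentBundle I G), IsLiftedMetric g₁ g₂ g →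
      (∀ (i j : Fin n) (p : TangentBundle I G),
        g.inner p (frameV X lam i p) (frameV X lam j p) = (if i = j then 1 else 0) ∧
        g.inner p (frameC X i p) (frameC X j p) = (if i = j then 1 else 0) ∧
        g.inner p (frameV X lam i p) (frameC X j p) = 0) ∧
      (∃ cov, IsLeviCivita g cov) ∧
      ∀ cov, IsLeviCivita g cov → ∀ (i j : Fin n) (p : TangentBundle I G),
        cov (frameV X lam j) p (frameV X lam i p) =
          (1 / 2 : ℝ) • ∑ l, (√(lam j) / √(lam i) * structureConst X l i j
            - √(lam i) / √(lam j) * structureConst X j l i) • frameC X l p ∧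
        cov (frameC X j) p (frameC X i p) =
          (1 / 2 : ℝ) • ∑ l, (structureConst X i j l - structureConst X j l i
            + structureConst X l i j) • frameC X l p ∧
        cov (frameV X lam j) p (frameC X i p) =
          (1 / 2 : ℝ) • ∑ l, (√(lam l) / √(lam j) * structureConst X i j l
            + √(lam j) / √(lam l) * structureConst X l i j) • frameV X lam l p ∧
        cov (frameC X j) p (frameV X lam i p) =
          (1 / 2 : ℝ) • ∑ l, (√(lam l) / √(lam i) * structureConst X i j l
            - √(lam i) / √(lam l) * structureConst X j l i) • frameV X lam l p := by
  have hpos := eigenvalue_pos hX hlam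
  have hF := isLocalFrameOn_liftFrame X lam hpos
  have hiff := isLiftedMetric_iff_isOrthonormalFrame hg₁ hg₂ hX hlam
  have : CompleteSpace E := FiniteDimensional.complete ℝ E
  refine ⟨hpos, ⟨frameMetric hF, (hiff _).2 (isOrthonormalFrame_frameMetric hF),
    fun g hg ↦ ((hiff g).1 hg).metric_ext hF (isOrthonormalFrame_frameMetric hF)⟩, fun g hg ↦ ?_⟩
  have ho := (hiff g).1 hg
  refine ⟨fun i j p ↦ ⟨(ho p (.inl i) (.inl j)).trans (by simp),
    (ho p (.inr i) (.inr j)).trans (by simp), (ho p (.inl i) (.inr j)).trans (by simp)⟩,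
    exists_isLeviCivita hF ho, fun cov hcov i j p ↦ ?_⟩
  -- The Koszul expansion is split into vertical and complete parts. Nonzero bracket coefficients
  -- have zero or two vertical indices, so only one of the two parts survives in each of the four
  -- cases.
  have key (a b : Fin n ⊕ Fin n) (s : TangentSpace I.tangent p)
      (hs : ∑ l, christoffel hF p a b (.inl l) • frameV X lam l p +
        ∑ l, christoffel hF p a b (.inr l) • frameC X l p = s) :
      cov (liftFrame X lam b) p (liftFrame X lam a p) = s :=
    (hcov.apply_frame hF ho p a b).trans ((Fintype.sum_sum_type _).trans hs)
  refine ⟨key (.inl i) (.inl j) _ ?_, key (.inr i) (.inr j) _ ?_, key (.inr i) (.inl j) _ ?_,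
    key (.inl i) (.inr j) _ ?_⟩ <;>
  simp only [christoffel, bracketCoeff_inr_inr, bracketCoeff_inl_inl,
    bracketCoeff_inr_inl hF p hpos, bracketCoeff_inl_inr hF p hpos, Sum.elim_inl, Sum.elim_inr,
    sub_zero, add_zero, mul_zero, zero_smul, Finset.sum_const_zero, zero_add, Finset.smul_sum,
    smul_smul] <;>
  refine Finset.sum_congr rfl fun l _ ↦ congrArg (· • _) ?_ <;>
  ring
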